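/- Let $n\ge 1$ and let $\mathbb H^n=\{\xi=(x,y,t)=(z,t): z=(x,y)\in\mathbb R^n\times\mathbb R^n,\ t\in\mathbb R\}$ be the Heisenberg group with the group law $\xi\circ\xi'=(x+x',\,y+y',\,t+t'+2\langle y,x'\rangle-2\langle x,y'\rangle)$, so that $\xi^{-1}=-\xi$, with Lebesgue measure $d\xi$, the gauge $d(\xi)=(|z|^4+t^2)^{1/4}$, the balls $B_R(0)=\{\xi: d(\xi)<R\}$ and the homogeneous dimension $Q=2n+2$. For measurable $f:\mathbb H^n\to\mathbb R$ put $$[f]_{s,p,\alpha}=\left(\int_{\mathbb H^n}\int_{\mathbb H^n}\frac{|f(\xi)-f(\xi')|^p\,d\xi'\,d\xi}{d(\xi^{-1}\circ\xi')^{Q+ps}\,|z-z'|^{(p-2)\alpha}}\right)^{1/p}\in[0,\infty].$$ **Theorem 1.3.** Let $p>1$, $s\in(0,1)$, $\alpha\in\mathbb R$ with $0\le(p-2)\alpha<Q-2$, $\tau>1$, $0<a\le 1$, $\gamma\in\mathbb R$ with $0\le-\gamma\le as$, and let $q\ge1$ satisfy $q>\dfrac{(1-a)\tau Q}{Q-2+\tau\gamma(p-2)\frac{\alpha}{ps}}$.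 Suppose that $$\frac1\tau+\frac{\gamma\left(1+(p-2)\frac{\alpha}{ps}\right)}{Q}=a\left(\frac1p-\frac{s\left(1+(p-2)\frac{\alpha}{ps}\right)}{Q}\right)+\frac{1-a}{q}\qquad\text{and}\qquad \frac1\tau+\frac{\gamma\left(1+(p-2)\frac{\alpha}{ps}\right)}{Q}=0.$$ Then there is a constant $C>0$, depending only on $n,p,s,\alpha,\tau,a,\gamma,q$, such that the following hold. (i) For every $R>0$ and every $f\in C^1_c(\mathbb H^n)$ with $\operatorname{supp}f\subset B_R(0)$, $$\left(\int_{\mathbb H^n}\frac{d(\xi)^{\tau\gamma}\,|z|^{\tau\gamma(p-2)\frac{\alpha}{ps}}}{\ln^{\tau}(4R/d(\xi))}\,|f(\xi)|^{\tau}\,d\xi\right)^{1/\tau}\le C\,[f]_{s,p,\alpha}^{a}\,\|f\|_{L^q(\mathbb H^n)}^{1-a}.$$ (ii) For every $r>0$ and every $f\in C^1_c(\mathbb H^n)$ with $\operatorname{supp}f\cap B_r(0)=\emptyset$, $$\left(\int_{\mathbb H^n}\frac{d(\xi)^{\tau\gamma}\,|z|^{\tau\gamma(p-2)\frac{\alpha}{ps}}}{\ln^{\tau}(4d(\xi)/r)}\,|f(\xi)|^{\tau}\,d\xi\right)^{1/\tau}\le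 C\,[f]_{s,p,\alpha}^{a}\,\|f\|_{L^q(\mathbb H^n)}^{1-a}.$$ Here the integrands are read as $0$ where $f=0$, both sides may take the value $\infty$, and $\|f\|_{L^q}^{0}=1$. -/

import Mathlib

open MeasureTheory

noncomputable section

/-- The underlying manifold of the Heisenberg group: points `(x, y, t)` with `x, y ∈ ℝⁿ` and
`t ∈ ℝ`. Its `volume` is the Lebesgue measure of `ℝ²ⁿ⁺¹`, which is the Haar measure of the group.
The group law is `Heisenberg.op` (not the componentwise addition of the product). -/
abbrev Heisenberg (n : ℕ) : Type :=
  EuclideanSpace ℝ (Fin n) × EuclideanSpace ℝ (Fin n) × ℝ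

namespace Heisenberg

variable {n : ℕ}

/-- The group law
`(x, y, t) ∘ (x', y', t') = (x + x', y + y', t + t' + 2⟨y, x'⟩ - 2⟨x, y'⟩)`. -/
def op (ξ η : Heisenberg n) : Heisenberg n :=
  (ξ.1 + η.1, ξ.2.1 + η.2.1,
    ξ.2.2 + η.2.2 + 2 * inner ℝ ξ.2.1 η.1 - 2 * inner ℝ ξ.1 η.2.1)

/-- The group inverse, `ξ⁻¹ = -ξ`. -/
def inverse (ξ : Heisenberg n) : Heisenberg n :=
  (-ξ.1, -ξ.2.1, -ξ.2.2)

/-- The Euclidean norm `|z|` of the horizontal part `z = (x, y) ∈ ℝ²ⁿ` of `ξ = (x, y, t)`. -/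
def zNorm (ξ : Heisenberg n) : ℝ :=
  Real.sqrt (‖ξ.1‖ ^ 2 + ‖ξ.2.1‖ ^ 2)

/-- The Koranyi-Folland gauge `d(ξ) = (|z|⁴ + t²)^(1/4)`. -/
def gauge (ξ : Heisenberg n) : ℝ :=
  (zNorm ξ ^ 4 + ξ.2.2 ^ 2) ^ (1 / 4 : ℝ)

/-- The gauge ball `B_r(ξ) = {ξ' : d(ξ⁻¹ ∘ ξ') < r}`. -/
def gaugeBall (ξ : Heisenberg n) (r : ℝ) : Set (Heisenberg n) :=
  {η | gauge (op (inverse ξ) η) < r}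

/-- The homogeneous dimension `Q = 2n + 2`. -/
def homDim (n : ℕ) : ℝ := 2 * (n : ℝ) + 2

/-- The fractional seminorm
`[f]_{s,p,α} = (∫∫ |f(ξ) - f(ξ')|^p / (d(ξ⁻¹ ∘ ξ')^(Q+ps) |z - z'|^((p-2)α)) dξ' dξ)^(1/p)`,
with values in `[0, ∞]`. -/
def seminorm (s p α : ℝ) (f : Heisenberg n → ℝ) : ENNReal :=
  (∫⁻ ξ : Heisenberg n, ∫⁻ η : Heisenberg n,
    ENNReal.ofReal (|f ξ - f η| ^ p /
      (gauge (op (inverse ξ) η) ^ (homDim n + p * s) * zNorm (ξ - η) ^ ((p - 2) * α)))) ^ (1 / p)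

end Heisenberg

end

/-!
The proof decomposes `ℍⁿ` into dyadic shells `{ρ ≤ d < 2ρ}` and compares `f` on each shell with
its mean value there.

Write `S = ps`, `κ = (p - 2)α`, `θ = κ / S`, `u = aτ / p`, `v = (1 - a)τ / q`. The balance and
criticality conditions give `(S + κ - Q)u = Qv` with `a > 0`, hence `S + κ ≥ Q`: the seminorm is
critical or better on the Heisenberg group, as `d^(Q + S) |z - z'|^κ ≤ d^(Q + S + κ)`. They also
make the weight `d^(-e) |z|^(-b)`, where `e = -τγ` and `b = -τγθ`, homogeneous of degree `-Q`, so
every dyadic shell has the same weighted measure and every local inequality may be rescaled to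
unit size (`exponent_relations`, `shellEnergy_rpow_mul_comp_dil`).

* On the unit shell, `f` minus its mean is a telescoping sum of differences of averages over
  gauge balls of radius `2^(-k-2)`. By `S + κ ≥ Q` each difference is bounded by the `1/p`-th power
  of the energy in the ball, and integrating against `|z|^(-β)`, `β < 2n`, gains a factor `4^(-k)`
  from the weighted measure of small balls. This yields the embedding into every weighted
  `L^σ`, `σ ≥ p` (`exists_lintegral_zWeight_mul_enorm_sub_rpow_le`); Hölder's inequality with the
  `L^q` norm then gives a Gagliardo–Nirenberg inequality. The lower bound on `q` is what leaves
  `|z|` an integrable power.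
* The same quantities bound the difference of the means over two adjacent shells. Since `f`
  vanishes on the shell next to the sphere of radius `R` (or `r`), its means on the other shells
  are sums of such differences. The logarithm in the weight is comparable to the index of
  the shell, and the discrete Hardy inequality (`ENNReal.hardy_tsum_le`), which needs `τ > 1`,
  bounds the weighted sum of the means by the sum of the differences.
* The local bounds are summed by `ENNReal.tsum_rpow_mul_rpow_le`, a Hölder inequality valid because
  `-γ ≤ as` gives `u + v ≥ 1`; the enlarged shells overlap at most five times.
-/

noncomputable section

/-! ### Sums, averages and Jensen's inequality -/

/-- The discrete Hardy inequality with its sharp constant, for finite sums. -/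
theorem Real.hardy_sum_range_le {τ : ℝ} (hτ : 1 < τ) {a : ℕ → ℝ} (ha : ∀ n, 0 ≤ a n) (N : ℕ) :
    ∑ n ∈ Finset.range N, ((∑ i ∈ Finset.range (n + 1), a i) / (n + 1)) ^ τ ≤
      (τ / (τ - 1)) ^ τ * ∑ n ∈ Finset.range N, a n ^ τ := by
  have hτ0 : 0 < τ := by linarith
  have hτ1 : 0 < τ - 1 := by linarith
  set S : ℕ → ℝ := fun n => ∑ i ∈ Finset.range n, a i with hS
  have hS0 : ∀ n, 0 ≤ S n := fun n => Finset.sum_nonneg fun i _ => ha i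
  set F : ℕ → ℝ := fun n => n * (S n / n) ^ τ with hF
  have hF0 : ∀ n, 0 ≤ F n := fun n => by
    have := hS0 n
    simp only [hF]; positivity
  set D : ℝ := τ / (τ - 1) with hD
  have hconj : τ.HolderConjugate D := by
    rw [hD]; exact Real.HolderConjugate.conjExponent hτ
  have hpow : ∀ y : ℝ, 0 ≤ y → (y ^ (τ - 1)) ^ D = y ^ τ := fun y hy => by
    rw [← Real.rpow_mul hy, hD]
    congr 1
    field_simp
  -- Elliott's argument: up to a telescoping term, `A ^ τ` is bounded by `D * (A ^ (τ - 1) * a)`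
  -- for the running means `A`, and Young's inequality then absorbs `A ^ (τ - 1)`.
  have key : ∀ n : ℕ, (S (n + 1) / (n + 1)) ^ τ + (F (n + 1) - F n) / (τ - 1) ≤
      D * ((S (n + 1) / (n + 1)) ^ (τ - 1) * a n) := by
    intro n
    set y := S (n + 1) / (n + 1) with hy
    set x := S n / n with hx
    have hy0 : 0 ≤ y := div_nonneg (hS0 _) (by positivity)
    have hx0 : 0 ≤ x := div_nonneg (hS0 _) (by positivity)
    have hnx : (n : ℝ) * x = S n := by
      rcases Nat.eq_zero_or_pos n with rfl | hn
      · simp [hS]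
      · rw [hx]; field_simp
    have han : a n = (n + 1) * y - n * x := by
      rw [hnx, hy]
      have : S (n + 1) = S n + a n := Finset.sum_range_succ _ _
      field_simp
      linarith
    have hFn : F n = n * x ^ τ := rfl
    have hFn1 : F (n + 1) = (n + 1) * y ^ τ := by simp [hF, hy]
    have hyy : y ^ (τ - 1) * y = y ^ τ := by
      conv_lhs => rw [← Real.rpow_one y, ← Real.rpow_mul hy0, one_mul]
      rw [← Real.rpow_add_of_nonneg hy0 (by linarith) (by norm_num)]
      congr 1; ring
    have hyoung := Real.young_inequality_of_nonneg hx0 (Real.rpow_nonneg hy0 (τ - 1)) hconj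
    rw [hpow y hy0] at hyoung
    have h1 : (n : ℝ) * (x * y ^ (τ - 1)) ≤ n * (x ^ τ / τ + y ^ τ / D) := by gcongr
    have h2 : D * ((n : ℝ) * (x * y ^ (τ - 1))) ≤ n * (x ^ τ / (τ - 1) + y ^ τ) := by
      calc D * ((n : ℝ) * (x * y ^ (τ - 1))) ≤ D * (n * (x ^ τ / τ + y ^ τ / D)) := by
            have : 0 ≤ D := by positivity
            gcongr
        _ = _ := by rw [hD]; field_simp
    have h3 : D * (y ^ (τ - 1) * a n) =
        D * (n + 1) * y ^ τ - D * ((n : ℝ) * (x * y ^ (τ - 1))) := by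
      rw [han, ← hyy]; ring
    rw [h3, hFn, hFn1]
    have h4 : y ^ τ + ((n + 1) * y ^ τ - n * x ^ τ) / (τ - 1) =
        D * (n + 1) * y ^ τ - n * (x ^ τ / (τ - 1) + y ^ τ) := by
      rw [hD]; field_simp; ring
    linarith
  have key2 : ∀ n : ℕ, (S (n + 1) / (n + 1)) ^ τ + τ * ((F (n + 1) - F n) / (τ - 1)) ≤
      (D * a n) ^ τ := by
    intro n
    have hy0 : 0 ≤ S (n + 1) / (n + 1) := div_nonneg (hS0 _) (by positivity)
    have hDa : 0 ≤ D * a n := mul_nonneg (by positivity) (ha n)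
    have hyoung := Real.young_inequality_of_nonneg hDa (Real.rpow_nonneg hy0 (τ - 1)) hconj
    rw [hpow _ hy0] at hyoung
    have h5 := key n
    have h6 : (S (n + 1) / (n + 1)) ^ τ / D = (S (n + 1) / (n + 1)) ^ τ -
        (S (n + 1) / (n + 1)) ^ τ / τ := by
      rw [hD]; field_simp
    have h7 : (S (n + 1) / (n + 1)) ^ τ / τ + (F (n + 1) - F n) / (τ - 1) ≤ (D * a n) ^ τ / τ := by
      linarith
    calc _ = τ * ((S (n + 1) / (n + 1)) ^ τ / τ + (F (n + 1) - F n) / (τ - 1)) := by field_simp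
      _ ≤ τ * ((D * a n) ^ τ / τ) := by gcongr
      _ = _ := by field_simp
  have hsum := Finset.sum_le_sum fun n (_ : n ∈ Finset.range N) => key2 n
  rw [Finset.sum_add_distrib, ← Finset.mul_sum, ← Finset.sum_div, Finset.sum_range_sub] at hsum
  have hFz : F 0 = 0 := by simp [hF]
  have h8 : 0 ≤ τ * ((F N - F 0) / (τ - 1)) := by
    rw [hFz, sub_zero]
    have := hF0 N
    positivity
  have h9 : ∑ n ∈ Finset.range N, (D * a n) ^ τ = D ^ τ * ∑ n ∈ Finset.range N, a n ^ τ := by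
    rw [Finset.mul_sum]
    refine Finset.sum_congr rfl fun n _ => ?_
    rw [Real.mul_rpow (by positivity) (ha n)]
  rw [h9] at hsum
  linarith

/-- The discrete Hardy inequality for a sequence starting at `0`, in terms of its increments. -/
theorem ENNReal.hardy_tsum_le {τ : ℝ} (hτ : 1 < τ) {c : ℕ → ℝ} (hc : c 0 = 0) :
    ∑' n : ℕ, ‖c n / (n + 1)‖ₑ ^ τ ≤
      ENNReal.ofReal ((τ / (τ - 1)) ^ τ) * ∑' n : ℕ, ‖c (n + 1) - c n‖ₑ ^ τ := by
  have hτ0 : 0 ≤ τ := by linarith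
  have he : ∀ x : ℝ, ‖x‖ₑ ^ τ = ENNReal.ofReal (|x| ^ τ) := fun x => by
    rw [← ENNReal.ofReal_rpow_of_nonneg (abs_nonneg x) hτ0, ← Real.norm_eq_abs, ofReal_norm]
  simp only [he]
  set a : ℕ → ℝ := fun n => |c (n + 1) - c n| with ha
  rw [ENNReal.tsum_eq_iSup_nat]
  refine iSup_le fun N => ?_
  have hcS : ∀ n, |c n| ≤ ∑ i ∈ Finset.range n, a i := by
    intro n
    have : c n = ∑ i ∈ Finset.range n, (c (i + 1) - c i) := by
      rw [Finset.sum_range_sub, hc, sub_zero]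
    rw [this]
    exact Finset.abs_sum_le_sum_abs _ _
  rw [← ENNReal.ofReal_sum_of_nonneg (fun i _ => by positivity)]
  calc ENNReal.ofReal (∑ n ∈ Finset.range N, |c n / (n + 1)| ^ τ)
      ≤ ENNReal.ofReal ((τ / (τ - 1)) ^ τ * ∑ n ∈ Finset.range N, a n ^ τ) := by
        apply ENNReal.ofReal_le_ofReal
        refine le_trans (Finset.sum_le_sum fun n _ => ?_)
          (Real.hardy_sum_range_le hτ (fun n => abs_nonneg _) N)
        rw [abs_div, abs_of_nonneg (by positivity : (0 : ℝ) ≤ n + 1)]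
        have := hcS n
        gcongr
        exact this.trans (Finset.sum_le_sum_of_subset_of_nonneg
          (Finset.range_mono (Nat.le_succ n)) fun _ _ _ => abs_nonneg _)
    _ = ENNReal.ofReal ((τ / (τ - 1)) ^ τ) * ∑ n ∈ Finset.range N, ENNReal.ofReal (a n ^ τ) := by
        have h0 : (0 : ℝ) ≤ (τ / (τ - 1)) ^ τ :=
          Real.rpow_nonneg (div_nonneg hτ0 (by linarith)) _
        rw [ENNReal.ofReal_mul h0, ENNReal.ofReal_sum_of_nonneg (fun i _ => by positivity)]
    _ ≤ _ := by gcongr; exact ENNReal.sum_le_tsum _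

/-- Hölder's inequality for sums with exponents satisfying `u + v ≥ 1` instead of `u + v = 1`. -/
theorem ENNReal.tsum_rpow_mul_rpow_le {u v : ℝ} (hv0 : 0 ≤ v) (hv1 : v ≤ 1) (huv : 1 - v ≤ u)
    (x y : ℕ → ENNReal) :
    ∑' j, x j ^ u * y j ^ v ≤ (∑' j, x j) ^ u * (∑' j, y j) ^ v := by
  have hu : u = (1 - v) + (u - (1 - v)) := by ring
  have hsplit : ∀ t : ENNReal, t ^ u = t ^ (1 - v) * t ^ (u - (1 - v)) := fun t => by
    conv_lhs => rw [hu]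
    exact ENNReal.rpow_add_of_nonneg _ _ (by linarith) (by linarith)
  have hH := ENNReal.lintegral_mul_norm_pow_le (μ := Measure.count) (f := x) (g := y)
    (measurable_of_countable _).aemeasurable (measurable_of_countable _).aemeasurable
    (sub_nonneg.2 hv1) hv0 (by ring)
  simp only [lintegral_count] at hH
  calc ∑' j, x j ^ u * y j ^ v
      ≤ ∑' j, (x j ^ (1 - v) * y j ^ v) * (∑' j, x j) ^ (u - (1 - v)) := by
        refine ENNReal.tsum_le_tsum fun j => ?_
        rw [hsplit, mul_right_comm]
        have : x j ≤ ∑' j, x j := ENNReal.le_tsum j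
        have h0 : 0 ≤ u - (1 - v) := by linarith
        gcongr
    _ = (∑' j, x j ^ (1 - v) * y j ^ v) * (∑' j, x j) ^ (u - (1 - v)) := ENNReal.tsum_mul_right
    _ ≤ ((∑' j, x j) ^ (1 - v) * (∑' j, y j) ^ v) * (∑' j, x j) ^ (u - (1 - v)) := by gcongr
    _ = _ := by rw [hsplit (∑' j, x j)]; ring

/-- Hölder's inequality against the geometric sequence `2^(-k/(σ-1))`: a sum may be moved inside a
power at the price of a geometrically growing factor. -/
theorem ENNReal.exists_tsum_rpow_le {σ : ℝ} (hσ : 1 < σ) :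
    ∃ C : ENNReal, C ≠ ⊤ ∧ ∀ a : ℕ → ENNReal,
      (∑' k, a k) ^ σ ≤ C * ∑' k, 2 ^ k * a k ^ σ := by
  have hσ0 : 0 < σ := by linarith
  set δ : ℝ := 1 / (σ - 1) with hδ
  have hδ0 : 0 < δ := by rw [hδ]; exact one_div_pos.2 (by linarith)
  set b : ENNReal := (2 : ENNReal) ^ (-δ) with hb
  have hb1 : b < 1 := ENNReal.rpow_lt_one_of_one_lt_of_neg (by norm_num) (by linarith)
  have hbs : ∑' k : ℕ, b ^ k = (1 - b)⁻¹ := ENNReal.tsum_geometric b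
  refine ⟨(∑' k : ℕ, b ^ k) ^ (σ - 1), ?_, fun a => ?_⟩
  · refine ENNReal.rpow_ne_top_of_nonneg (by linarith) ?_
    rw [hbs, ENNReal.inv_ne_top]
    exact (tsub_pos_of_lt hb1).ne'
  have hH := ENNReal.lintegral_mul_norm_pow_le (μ := Measure.count)
    (f := fun k : ℕ => 2 ^ k * a k ^ σ) (g := fun k : ℕ => b ^ k)
    (measurable_of_countable _).aemeasurable (measurable_of_countable _).aemeasurable
    (p := 1 / σ) (q := 1 - 1 / σ) (by positivity)
    (sub_nonneg.2 ((div_le_one hσ0).2 hσ.le)) (by ring)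
  simp only [lintegral_count] at hH
  have hterm : ∀ k : ℕ, (2 ^ k * a k ^ σ) ^ (1 / σ) * (b ^ k) ^ (1 - 1 / σ) = a k := by
    intro k
    rw [ENNReal.mul_rpow_of_nonneg _ _ (by positivity), ← ENNReal.rpow_mul,
      mul_one_div_cancel hσ0.ne', ENNReal.rpow_one, hb, ← ENNReal.rpow_natCast,
      ← ENNReal.rpow_natCast, ← ENNReal.rpow_mul, ← ENNReal.rpow_mul, ← ENNReal.rpow_mul,
      mul_right_comm, ← ENNReal.rpow_add _ _ (by norm_num) (by norm_num)]
    have : (k : ℝ) * (1 / σ) + -δ * (k * (1 - 1 / σ)) = 0 := by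
      have : σ - 1 ≠ 0 := by linarith
      rw [hδ]; field_simp; ring
    rw [this, ENNReal.rpow_zero, one_mul]
  simp only [hterm] at hH
  calc (∑' k, a k) ^ σ ≤ ((∑' k, 2 ^ k * a k ^ σ) ^ (1 / σ) * (∑' k, b ^ k) ^ (1 - 1 / σ)) ^ σ := by
        gcongr
    _ = _ := by
        rw [ENNReal.mul_rpow_of_nonneg _ _ hσ0.le, ← ENNReal.rpow_mul, ← ENNReal.rpow_mul,
          one_div_mul_cancel hσ0.ne', ENNReal.rpow_one, mul_comm]
        congr 2
        field_simp

theorem lintegral_rpow_le_of_isProbabilityMeasure {α : Type*} [MeasurableSpace α] {ν : Measure α}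
    [IsProbabilityMeasure ν] {p : ℝ} (hp : 1 ≤ p) {g : α → ENNReal} (hg : AEMeasurable g ν) :
    (∫⁻ x, g x ∂ν) ^ p ≤ ∫⁻ x, g x ^ p ∂ν := by
  have hp0 : 0 < p := by linarith
  have hH := ENNReal.lintegral_mul_norm_pow_le (μ := ν) (f := fun x => g x ^ p) (g := fun _ => 1)
    (hg.pow_const p) aemeasurable_const (p := 1 / p) (q := 1 - 1 / p) (by positivity)
    (sub_nonneg.2 ((div_le_one hp0).2 hp)) (by ring)
  simp only [ENNReal.one_rpow, mul_one, ← ENNReal.rpow_mul, mul_one_div_cancel hp0.ne',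
    ENNReal.rpow_one, lintegral_const, measure_univ] at hH
  calc _ ≤ ((∫⁻ x, g x ^ p ∂ν) ^ (1 / p)) ^ p := by gcongr
    _ = _ := by rw [← ENNReal.rpow_mul, one_div_mul_cancel hp0.ne', ENNReal.rpow_one]

/-- Jensen's inequality for the difference of two means. -/
theorem enorm_integral_sub_integral_rpow_le {α : Type*} [MeasurableSpace α] {ν₁ ν₂ : Measure α}
    [IsProbabilityMeasure ν₁] [IsProbabilityMeasure ν₂] {p : ℝ} (hp : 1 ≤ p) {h : α → ℝ}
    (h₁ : Integrable h ν₁) (h₂ : Integrable h ν₂) :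
    ‖∫ x, h x ∂ν₁ - ∫ x, h x ∂ν₂‖ₑ ^ p ≤ ∫⁻ x, ∫⁻ y, ‖h x - h y‖ₑ ^ p ∂ν₂ ∂ν₁ := by
  have hp0 : 0 ≤ p := by linarith
  have hin : ∀ x, h x - ∫ y, h y ∂ν₂ = ∫ y, (h x - h y) ∂ν₂ := fun x => by
    rw [integral_sub (integrable_const _) h₂]; simp
  have hout : ∫ x, h x ∂ν₁ - ∫ x, h x ∂ν₂ = ∫ x, (h x - ∫ y, h y ∂ν₂) ∂ν₁ := by
    rw [integral_sub h₁ (integrable_const _)]; simp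
  have hm : AEMeasurable (fun x => ‖h x - ∫ y, h y ∂ν₂‖ₑ) ν₁ :=
    (h₁.aestronglyMeasurable.sub aestronglyMeasurable_const).enorm
  calc ‖∫ x, h x ∂ν₁ - ∫ x, h x ∂ν₂‖ₑ ^ p
      ≤ (∫⁻ x, ‖h x - ∫ y, h y ∂ν₂‖ₑ ∂ν₁) ^ p := by
        rw [hout]; gcongr; exact enorm_integral_le_lintegral_enorm _
    _ ≤ ∫⁻ x, ‖h x - ∫ y, h y ∂ν₂‖ₑ ^ p ∂ν₁ := lintegral_rpow_le_of_isProbabilityMeasure hp hm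
    _ ≤ _ := by
        refine lintegral_mono fun x => ?_
        rw [hin]
        have hm2 : AEMeasurable (fun y => ‖h x - h y‖ₑ) ν₂ :=
          (aestronglyMeasurable_const.sub h₂.aestronglyMeasurable).enorm
        calc _ ≤ (∫⁻ y, ‖h x - h y‖ₑ ∂ν₂) ^ p := by
              gcongr; exact enorm_integral_le_lintegral_enorm _
          _ ≤ _ := lintegral_rpow_le_of_isProbabilityMeasure hp hm2

section Averages

variable {α : Type*} [MeasurableSpace α] {μ : Measure α} {S T : Set α} {p : ℝ} {h : α → ℝ}

theorem isProbabilityMeasure_inv_smul_restrict (hS0 : μ S ≠ 0) (hS : μ S ≠ ⊤) :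
    IsProbabilityMeasure (((μ.restrict S) Set.univ)⁻¹ • μ.restrict S) := by
  constructor
  simp [ENNReal.inv_mul_cancel hS0 hS]

theorem enorm_setAverage_sub_setAverage_rpow_le (hp : 1 ≤ p) (hS0 : μ S ≠ 0) (hS : μ S ≠ ⊤)
    (hT0 : μ T ≠ 0) (hT : μ T ≠ ⊤) (hh : Integrable h μ) :
    ‖(⨍ x in S, h x ∂μ) - ⨍ x in T, h x ∂μ‖ₑ ^ p ≤
      (μ S)⁻¹ * (μ T)⁻¹ * ∫⁻ x in S, ∫⁻ y in T, ‖h x - h y‖ₑ ^ p ∂μ ∂μ := by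
  have := isProbabilityMeasure_inv_smul_restrict hS0 hS
  have := isProbabilityMeasure_inv_smul_restrict hT0 hT
  have hmain := enorm_integral_sub_integral_rpow_le hp
    (ν₁ := ((μ.restrict S) Set.univ)⁻¹ • μ.restrict S)
    (ν₂ := ((μ.restrict T) Set.univ)⁻¹ • μ.restrict T)
    (hh.restrict.smul_measure (by simpa using hS0)) (hh.restrict.smul_measure (by simpa using hT0))
  refine hmain.trans_eq ?_
  simp only [lintegral_smul_measure, smul_eq_mul, Measure.restrict_apply_univ]
  rw [lintegral_const_mul' _ _ (ENNReal.inv_ne_top.2 hT0), mul_assoc]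

theorem enorm_sub_setAverage_rpow_le (hp : 1 ≤ p) (c : ℝ) (hT0 : μ T ≠ 0) (hT : μ T ≠ ⊤)
    (hh : Integrable h μ) :
    ‖c - ⨍ x in T, h x ∂μ‖ₑ ^ p ≤ (μ T)⁻¹ * ∫⁻ y in T, ‖c - h y‖ₑ ^ p ∂μ := by
  have := isProbabilityMeasure_inv_smul_restrict hT0 hT
  have hi : Integrable h (((μ.restrict T) Set.univ)⁻¹ • μ.restrict T) :=
    hh.restrict.smul_measure (by simpa using hT0)
  have h1 : c - ⨍ x in T, h x ∂μ = ∫ y, (c - h y) ∂(((μ.restrict T) Set.univ)⁻¹ • μ.restrict T) := by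
    rw [integral_sub (integrable_const _) hi, integral_const, probReal_univ, one_smul]; rfl
  have hm2 : AEMeasurable (fun y => ‖c - h y‖ₑ) (((μ.restrict T) Set.univ)⁻¹ • μ.restrict T) :=
    (aestronglyMeasurable_const.sub hi.aestronglyMeasurable).enorm
  calc _ ≤ (∫⁻ y, ‖c - h y‖ₑ ∂(((μ.restrict T) Set.univ)⁻¹ • μ.restrict T)) ^ p := by
        rw [h1]; gcongr; exact enorm_integral_le_lintegral_enorm _
    _ ≤ _ := lintegral_rpow_le_of_isProbabilityMeasure hp hm2
    _ = _ := by simp only [lintegral_smul_measure, smul_eq_mul, Measure.restrict_apply_univ]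

end Averages

/-! ### Dilations, translations and gauge balls -/

namespace Heisenberg
variable {n : ℕ}

/-- The anisotropic dilation `(z, t) ↦ (ρz, ρ²t)`, under which the gauge is homogeneous of degree
one. -/
def dil (ρ : ℝ) (ξ : Heisenberg n) : Heisenberg n := (ρ • ξ.1, ρ • ξ.2.1, ρ ^ 2 * ξ.2.2)

/-- The half-open gauge shell `{a ≤ d < b}` around the origin. -/
def shell (a b : ℝ) : Set (Heisenberg n) := {ξ | a ≤ gauge ξ ∧ gauge ξ < b}

theorem zNorm_nonneg (ξ : Heisenberg n) : 0 ≤ zNorm ξ := Real.sqrt_nonneg _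

theorem zNorm_sq (ξ : Heisenberg n) : zNorm ξ ^ 2 = ‖ξ.1‖ ^ 2 + ‖ξ.2.1‖ ^ 2 :=
  Real.sq_sqrt (by positivity)

theorem gauge_nonneg (ξ : Heisenberg n) : 0 ≤ gauge ξ :=
  Real.rpow_nonneg (by have := zNorm_nonneg ξ; positivity) _

theorem gauge_pow_four (ξ : Heisenberg n) : gauge ξ ^ 4 = zNorm ξ ^ 4 + ξ.2.2 ^ 2 := by
  have h : 0 ≤ zNorm ξ ^ 4 + ξ.2.2 ^ 2 := by have := zNorm_nonneg ξ; positivity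
  rw [gauge, ← Real.rpow_natCast, ← Real.rpow_mul h]; norm_num

theorem gauge_le_iff {ξ : Heisenberg n} {r : ℝ} (hr : 0 ≤ r) :
    gauge ξ ≤ r ↔ zNorm ξ ^ 4 + ξ.2.2 ^ 2 ≤ r ^ 4 := by
  rw [← gauge_pow_four, pow_le_pow_iff_left₀ (gauge_nonneg ξ) hr (by norm_num)]

theorem zNorm_le_gauge (ξ : Heisenberg n) : zNorm ξ ≤ gauge ξ := by
  rw [← pow_le_pow_iff_left₀ (zNorm_nonneg ξ) (gauge_nonneg ξ) (by norm_num : (4 : ℕ) ≠ 0),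
    gauge_pow_four]
  nlinarith [sq_nonneg ξ.2.2]

theorem abs_snd_snd_le (ξ : Heisenberg n) : |ξ.2.2| ≤ gauge ξ ^ 2 := by
  apply abs_le_of_sq_le_sq _ (by positivity)
  rw [← pow_mul, gauge_pow_four]
  have := zNorm_nonneg ξ
  have : 0 ≤ zNorm ξ ^ 4 := by positivity
  linarith

theorem norm_fst_le (ξ : Heisenberg n) : ‖ξ.1‖ ≤ zNorm ξ :=
  Real.le_sqrt_of_sq_le (by nlinarith [sq_nonneg ‖ξ.2.1‖])

theorem norm_snd_fst_le (ξ : Heisenberg n) : ‖ξ.2.1‖ ≤ zNorm ξ :=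
  Real.le_sqrt_of_sq_le (by nlinarith [sq_nonneg ‖ξ.1‖])

@[fun_prop]
theorem continuous_zNorm : Continuous (zNorm : Heisenberg n → ℝ) := by
  unfold zNorm; fun_prop

@[fun_prop]
theorem continuous_gauge : Continuous (gauge : Heisenberg n → ℝ) := by
  unfold gauge
  exact Continuous.rpow_const (by fun_prop) fun _ => Or.inr (by norm_num)

@[fun_prop]
theorem continuous_inverse : Continuous (inverse : Heisenberg n → Heisenberg n) := by
  unfold inverse; fun_prop

theorem continuous_op : Continuous fun x : Heisenberg n × Heisenberg n => op x.1 x.2 := by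
  unfold op; fun_prop

@[fun_prop]
theorem _root_.Continuous.heisenberg_op {X : Type*} [TopologicalSpace X] {f g : X → Heisenberg n}
    (hf : Continuous f) (hg : Continuous g) : Continuous fun x => op (f x) (g x) :=
  continuous_op.comp (hf.prodMk hg)

@[fun_prop]
theorem continuous_dil (ρ : ℝ) : Continuous (dil ρ : Heisenberg n → Heisenberg n) := by
  unfold dil; fun_prop

theorem measurableSet_shell (a b : ℝ) : MeasurableSet (shell a b : Set (Heisenberg n)) :=
  (measurableSet_le measurable_const continuous_gauge.measurable).inter
    (measurableSet_lt continuous_gauge.measurable measurable_const)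

theorem isOpen_gaugeBall (ξ : Heisenberg n) (r : ℝ) : IsOpen (gaugeBall ξ r) :=
  isOpen_lt (by fun_prop) continuous_const

theorem zNorm_dil {ρ : ℝ} (hρ : 0 ≤ ρ) (ξ : Heisenberg n) : zNorm (dil ρ ξ) = ρ * zNorm ξ := by
  rw [zNorm, zNorm, dil]
  simp only [norm_smul, mul_pow, Real.norm_eq_abs, sq_abs]
  rw [← mul_add, Real.sqrt_mul (by positivity), Real.sqrt_sq hρ]

theorem gauge_dil {ρ : ℝ} (hρ : 0 ≤ ρ) (ξ : Heisenberg n) : gauge (dil ρ ξ) = ρ * gauge ξ := by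
  rw [← pow_left_inj₀ (gauge_nonneg _) (mul_nonneg hρ (gauge_nonneg _)) (by norm_num : (4 : ℕ) ≠ 0),
    gauge_pow_four, mul_pow, gauge_pow_four, zNorm_dil hρ]
  simp only [dil]; ring

theorem op_inverse_dil (ρ : ℝ) (ξ η : Heisenberg n) :
    op (inverse (dil ρ ξ)) (dil ρ η) = dil ρ (op (inverse ξ) η) := by
  simp only [op, inverse, dil, Prod.mk.injEq, smul_add, smul_neg, inner_neg_left,
    inner_smul_left, inner_smul_right, true_and]
  simp; ring

theorem dil_sub_dil (ρ : ℝ) (ξ η : Heisenberg n) : dil ρ ξ - dil ρ η = dil ρ (ξ - η) := by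
  simp only [dil, Prod.mk_sub_mk, Prod.fst_sub, Prod.snd_sub, smul_sub, mul_sub]

theorem dil_dil (ρ ρ' : ℝ) (ξ : Heisenberg n) : dil ρ (dil ρ' ξ) = dil (ρ * ρ') ξ := by
  simp only [dil, smul_smul, Prod.mk.injEq, true_and]; ring

theorem inverse_op_swap (ξ η : Heisenberg n) :
    op (inverse η) ξ = inverse (op (inverse ξ) η) := by
  simp only [op, inverse, Prod.mk.injEq, inner_neg_left]
  refine ⟨by abel, by abel, ?_⟩
  rw [real_inner_comm, real_inner_comm ξ.2.1]; ring

theorem gauge_inverse (ξ : Heisenberg n) : gauge (inverse ξ) = gauge ξ := by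
  simp [gauge, zNorm, inverse]

theorem gauge_op_comm (ξ η : Heisenberg n) :
    gauge (op (inverse ξ) η) = gauge (op (inverse η) ξ) := by
  rw [inverse_op_swap η ξ, gauge_inverse]

theorem op_cancel (ξ η ζ : Heisenberg n) :
    op (op (inverse ξ) η) (op (inverse η) ζ) = op (inverse ξ) ζ := by
  simp only [op, inverse, Prod.mk.injEq, inner_neg_left, inner_add_left, inner_add_right,
    inner_neg_right]
  refine ⟨by abel, by abel, ?_⟩
  rw [real_inner_comm η.1 η.2.1]; ring

theorem op_inverse_op (ξ η : Heisenberg n) : op (inverse ξ) (op ξ η) = η := by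
  ext1
  · simp [op, inverse]
  · ext1
    · simp [op, inverse]
    · simp only [op, inverse, inner_neg_left, inner_add_right]
      rw [real_inner_comm ξ.1 ξ.2.1]; ring

theorem op_inverse_zero (ξ : Heisenberg n) : op (inverse 0) ξ = ξ := by
  simp [op, inverse]

theorem op_inverse_self (ξ : Heisenberg n) : op (inverse ξ) ξ = 0 := by
  ext1
  · simp [op, inverse]
  · ext1
    · simp [op, inverse]
    · simp only [op, inverse, inner_neg_left]
      rw [real_inner_comm ξ.1 ξ.2.1]; simp

theorem gauge_zero : gauge (0 : Heisenberg n) = 0 := by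
  simp [gauge, zNorm]

/-- The quasi-triangle inequality at the origin. The constant `3` is not optimal; the
width of the enlarged shells `{1/4 ≤ d < 8}` is adapted to it. -/
theorem gauge_op_le {ξ η : Heisenberg n} {M : ℝ} (hξ : gauge ξ ≤ M) (hη : gauge η ≤ M) :
    gauge (op ξ η) ≤ 3 * M := by
  have hM : 0 ≤ M := (gauge_nonneg ξ).trans hξ
  have hz := (zNorm_le_gauge ξ).trans hξ
  have hz' := (zNorm_le_gauge η).trans hη
  have ht : |ξ.2.2| ≤ M ^ 2 := (abs_snd_snd_le ξ).trans (by have := gauge_nonneg ξ; gcongr)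
  have ht' : |η.2.2| ≤ M ^ 2 := (abs_snd_snd_le η).trans (by have := gauge_nonneg η; gcongr)
  have hx := (norm_fst_le ξ).trans hz
  have hy := (norm_snd_fst_le ξ).trans hz
  have hx' := (norm_fst_le η).trans hz'
  have hy' := (norm_snd_fst_le η).trans hz'
  have hzz : zNorm (op ξ η) ^ 2 ≤ 4 * M ^ 2 := by
    have h1 : ‖ξ.1 + η.1‖ ^ 2 ≤ 2 * ‖ξ.1‖ ^ 2 + 2 * ‖η.1‖ ^ 2 := by
      have := norm_add_le ξ.1 η.1
      nlinarith [sq_nonneg (‖ξ.1‖ - ‖η.1‖), norm_nonneg (ξ.1 + η.1)]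
    have h2 : ‖ξ.2.1 + η.2.1‖ ^ 2 ≤ 2 * ‖ξ.2.1‖ ^ 2 + 2 * ‖η.2.1‖ ^ 2 := by
      have := norm_add_le ξ.2.1 η.2.1
      nlinarith [sq_nonneg (‖ξ.2.1‖ - ‖η.2.1‖), norm_nonneg (ξ.2.1 + η.2.1)]
    have h3 : zNorm ξ ^ 2 ≤ M ^ 2 := by have := zNorm_nonneg ξ; gcongr
    have h4 : zNorm η ^ 2 ≤ M ^ 2 := by have := zNorm_nonneg η; gcongr
    rw [zNorm_sq] at h3 h4 ⊢
    simp only [op]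
    linarith
  have hi1 : |inner ℝ ξ.2.1 η.1| ≤ M * M :=
    (abs_real_inner_le_norm _ _).trans (mul_le_mul hy hx' (norm_nonneg _) hM)
  have hi2 : |inner ℝ ξ.1 η.2.1| ≤ M * M :=
    (abs_real_inner_le_norm _ _).trans (mul_le_mul hx hy' (norm_nonneg _) hM)
  have htt : |(op ξ η).2.2| ≤ 6 * M ^ 2 := by
    simp only [op]
    rw [abs_le] at *
    constructor <;> nlinarith
  rw [gauge_le_iff (by positivity)]
  have h5 : zNorm (op ξ η) ^ 4 ≤ 16 * M ^ 4 := by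
    calc zNorm (op ξ η) ^ 4 = (zNorm (op ξ η) ^ 2) ^ 2 := by ring
      _ ≤ (4 * M ^ 2) ^ 2 := by gcongr
      _ = _ := by ring
  have h6 : (op ξ η).2.2 ^ 2 ≤ 36 * M ^ 4 := by
    calc (op ξ η).2.2 ^ 2 = |(op ξ η).2.2| ^ 2 := (sq_abs _).symm
      _ ≤ (6 * M ^ 2) ^ 2 := by gcongr
      _ = _ := by ring
  have h7 : 0 ≤ M ^ 4 := by positivity
  have h8 : (3 * M) ^ 4 = 81 * M ^ 4 := by ring
  linarith

theorem gauge_triangle {ξ η ζ : Heisenberg n} {M : ℝ} (h₁ : gauge (op (inverse ξ) η) ≤ M)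
    (h₂ : gauge (op (inverse η) ζ) ≤ M) : gauge (op (inverse ξ) ζ) ≤ 3 * M := by
  rw [← op_cancel ξ η ζ]; exact gauge_op_le h₁ h₂

theorem zNorm_sub_le_gauge (ξ η : Heisenberg n) : zNorm (ξ - η) ≤ gauge (op (inverse ξ) η) := by
  refine le_trans (le_of_eq ?_) (zNorm_le_gauge _)
  rw [zNorm, zNorm]
  simp only [op, inverse, Prod.fst_sub, Prod.snd_sub]
  rw [neg_add_eq_sub, neg_add_eq_sub, norm_sub_rev, norm_sub_rev ξ.2.1]

theorem map_dil {ρ : ℝ} (hρ : 0 < ρ) :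
    Measure.map (dil ρ : Heisenberg n → Heisenberg n) volume =
      ENNReal.ofReal (ρ ^ (-homDim n)) • (volume : Measure (Heisenberg n)) := by
  have hE : Measure.map (fun x : EuclideanSpace ℝ (Fin n) => ρ • x) volume =
      ENNReal.ofReal (ρ ^ (-(n : ℝ))) • volume := by
    rw [Measure.map_addHaar_smul _ hρ.ne']
    congr 2
    rw [finrank_euclideanSpace_fin, abs_of_pos (by positivity), Real.rpow_neg hρ.le,
      Real.rpow_natCast]
  have hR : Measure.map (fun x : ℝ => ρ ^ 2 * x) volume =
      ENNReal.ofReal (ρ ^ (-(2 : ℝ))) • volume := by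
    have := Measure.map_addHaar_smul (volume : Measure ℝ) (r := ρ ^ 2) (by positivity)
    simp only [smul_eq_mul] at this
    rw [this]
    congr 2
    rw [Module.finrank_self, pow_one, abs_of_pos (by positivity), Real.rpow_neg hρ.le]
    norm_cast
  have hdil : (dil ρ : Heisenberg n → Heisenberg n) =
      Prod.map (fun x => ρ • x) (Prod.map (fun x => ρ • x) fun x => ρ ^ 2 * x) := rfl
  have hsf : ∀ (c : ℝ) {X : Type} [MeasureSpace X] [SFinite (volume : Measure X)],
      SFinite (ENNReal.ofReal c • (volume : Measure X)) := fun c X _ _ => inferInstance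
  rw [hdil, Measure.volume_eq_prod, ← Measure.map_prod_map _ _ (by fun_prop) (by fun_prop),
    Measure.volume_eq_prod, ← Measure.map_prod_map _ _ (by fun_prop) (by fun_prop), hE, hR,
    Measure.prod_smul_left, Measure.prod_smul_left, Measure.prod_smul_right,
    Measure.prod_smul_right, Measure.prod_smul_right, smul_smul, smul_smul,
    ← ENNReal.ofReal_mul (by positivity), ← ENNReal.ofReal_mul (by positivity),
    ← Real.rpow_add hρ, ← Real.rpow_add hρ]
  congr 3
  rw [homDim]; ring

theorem lintegral_comp_dil {ρ : ℝ} (hρ : 0 < ρ) {F : Heisenberg n → ENNReal} (hF : Measurable F) :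
    ∫⁻ ξ, F (dil ρ ξ) = ENNReal.ofReal (ρ ^ (-homDim n)) * ∫⁻ ξ, F ξ := by
  rw [← lintegral_map hF (continuous_dil ρ).measurable, map_dil hρ, lintegral_smul_measure,
    smul_eq_mul]

/-- Left translation is a translation followed by shears, hence preserves Lebesgue measure. -/
theorem measurePreserving_op (ξ : Heisenberg n) :
    MeasurePreserving (op ξ) (volume : Measure (Heisenberg n)) volume := by
  refine MeasurePreserving.skew_product (μa := volume) (μb := volume) (μc := volume) (μd := volume)
    (measurePreserving_add_left volume ξ.1)
    (g := fun (x' : EuclideanSpace ℝ (Fin n)) (w : EuclideanSpace ℝ (Fin n) × ℝ) =>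
      (ξ.2.1 + w.1, ξ.2.2 + w.2 + 2 * inner ℝ ξ.2.1 x' - 2 * inner ℝ ξ.1 w.1))
    (by unfold Function.uncurry; fun_prop) (Filter.Eventually.of_forall fun x' => ?_)
  refine (MeasurePreserving.skew_product (μa := volume) (μb := volume) (μc := volume)
    (μd := volume) (measurePreserving_add_left volume ξ.2.1)
    (g := fun (y' : EuclideanSpace ℝ (Fin n)) (t' : ℝ) =>
      ξ.2.2 + t' + 2 * inner ℝ ξ.2.1 x' - 2 * inner ℝ ξ.1 y')
    (by unfold Function.uncurry; fun_prop) (Filter.Eventually.of_forall fun y' => ?_)).map_eq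
  have : (fun t' : ℝ => ξ.2.2 + t' + 2 * inner ℝ ξ.2.1 x' - 2 * inner ℝ ξ.1 y') =
      fun t' => (ξ.2.2 + 2 * inner ℝ ξ.2.1 x' - 2 * inner ℝ ξ.1 y') + t' := by
    funext t'; ring
  rw [this]
  exact (measurePreserving_add_left volume _).map_eq

theorem volume_gaugeBall (ξ : Heisenberg n) (r : ℝ) :
    volume (gaugeBall ξ r) = volume (gaugeBall (0 : Heisenberg n) r) := by
  rw [← (measurePreserving_op ξ).measure_preimage
    (isOpen_gaugeBall ξ r).measurableSet.nullMeasurableSet]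
  congr 1
  ext η
  simp [gaugeBall, op_inverse_op, op_inverse_zero]

theorem volume_gaugeBall_zero {r : ℝ} (hr : 0 < r) :
    volume (gaugeBall (0 : Heisenberg n) r) =
      ENNReal.ofReal (r ^ homDim n) * volume (gaugeBall (0 : Heisenberg n) 1) := by
  have h := congrArg (fun μ => μ (gaugeBall (0 : Heisenberg n) r)) (map_dil (n := n) hr)
  simp only [Measure.smul_apply, smul_eq_mul] at h
  rw [Measure.map_apply (continuous_dil r).measurable (isOpen_gaugeBall 0 r).measurableSet] at h
  have hpre : dil r ⁻¹' gaugeBall (0 : Heisenberg n) r = gaugeBall 0 1 := by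
    ext η
    simp only [gaugeBall, op_inverse_zero, Set.mem_preimage, Set.mem_ofPred_eq, gauge_dil hr.le]
    exact mul_lt_iff_lt_one_right hr
  rw [← hpre, h, ← mul_assoc, ← ENNReal.ofReal_mul (by positivity), ← Real.rpow_add hr]
  simp

theorem gaugeBall_zero_subset (r : ℝ) : gaugeBall (0 : Heisenberg n) r ⊆
    Metric.ball 0 r ×ˢ Metric.ball 0 r ×ˢ Metric.ball 0 (r ^ 2) := by
  intro ξ hξ
  simp only [gaugeBall, op_inverse_zero, Set.mem_ofPred_eq] at hξ
  have h0 := gauge_nonneg ξ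
  simp only [Set.mem_prod, mem_ball_zero_iff]
  refine ⟨((norm_fst_le ξ).trans (zNorm_le_gauge ξ)).trans_lt hξ,
    ((norm_snd_fst_le ξ).trans (zNorm_le_gauge ξ)).trans_lt hξ, ?_⟩
  refine lt_of_le_of_lt (abs_snd_snd_le ξ) ?_
  gcongr

theorem volume_gaugeBall_ne_top (ξ : Heisenberg n) (r : ℝ) : volume (gaugeBall ξ r) ≠ ⊤ := by
  rw [volume_gaugeBall]
  refine ((measure_mono (gaugeBall_zero_subset r)).trans_lt ?_).ne
  exact (Metric.isBounded_ball.prod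
    (Metric.isBounded_ball.prod Metric.isBounded_ball)).measure_lt_top

theorem volume_gaugeBall_ne_zero (ξ : Heisenberg n) {r : ℝ} (hr : 0 < r) :
    volume (gaugeBall ξ r) ≠ 0 :=
  ((isOpen_gaugeBall ξ r).measure_pos volume ⟨ξ, by
    simpa [gaugeBall, op_inverse_self, gauge_zero] using hr⟩).ne'

theorem shell_subset_gaugeBall (a b : ℝ) : shell a b ⊆ gaugeBall (0 : Heisenberg n) b := by
  intro ξ hξ
  simpa [gaugeBall, op_inverse_zero] using hξ.2

theorem volume_shell_ne_top (a b : ℝ) : volume (shell a b : Set (Heisenberg n)) ≠ ⊤ :=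
  ((measure_mono (shell_subset_gaugeBall a b)).trans_lt
    (volume_gaugeBall_ne_top 0 b).lt_top).ne

theorem volume_shell_ne_zero {a b : ℝ} (ha : 0 ≤ a) (hab : a < b) :
    volume (shell a b : Set (Heisenberg n)) ≠ 0 := by
  have hopen : IsOpen {ξ : Heisenberg n | a < gauge ξ ∧ gauge ξ < b} :=
    (isOpen_lt continuous_const continuous_gauge).inter
      (isOpen_lt continuous_gauge continuous_const)
  refine fun h => (hopen.measure_pos volume ⟨((0, 0, ((a + b) / 2) ^ 2) : Heisenberg n), ?_⟩).ne'
    (measure_mono_null (t := shell a b) (fun ξ hξ => And.intro hξ.1.le hξ.2) h)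
  have : gauge ((0, 0, ((a + b) / 2) ^ 2) : Heisenberg n) = (a + b) / 2 := by
    rw [← pow_left_inj₀ (gauge_nonneg _) (by linarith) (by norm_num : (4 : ℕ) ≠ 0), gauge_pow_four]
    simp [zNorm]; ring
  simp only [Set.mem_ofPred_eq, this]
  constructor <;> linarith

end Heisenberg

/-! ### The weight `|z|^(-β)` -/

theorem lintegral_ball_enorm_rpow_neg_ne_top {E : Type*} [NormedAddCommGroup E] [NormedSpace ℝ E]
    [FiniteDimensional ℝ E] [MeasurableSpace E] [BorelSpace E] (μ : Measure E) [μ.IsAddHaarMeasure]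
    (hE : 1 ≤ Module.finrank ℝ E) {κ : ℝ} (hκ : κ < Module.finrank ℝ E) (r : ℝ) :
    ∫⁻ x in Metric.ball (0 : E) r, ‖x‖ₑ ^ (-κ) ∂μ ≠ ⊤ := by
  have : Nontrivial E := Module.nontrivial_of_finrank_pos (R := ℝ) hE
  have hint : IntegrableOn (fun x : E => ‖x‖ ^ (-κ)) (Metric.ball 0 r) μ := by
    refine integrableOn_ball_of_norm_le_rpow (C := 1) hE hκ
      (Filter.Eventually.of_forall fun x => ?_)
      (by fun_prop : Measurable fun x : E => ‖x‖ ^ (-κ)).aestronglyMeasurable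
    rw [one_mul, Real.norm_of_nonneg (by positivity)]
  refine ne_of_lt (lt_of_le_of_lt (le_of_eq ?_) hint.2)
  refine lintegral_congr_ae ?_
  refine ae_restrict_of_ae ?_
  filter_upwards [compl_mem_ae_iff.2 (measure_singleton (μ := μ) (0 : E))] with x hx
  have hx0 : 0 < ‖x‖ := norm_pos_iff.2 hx
  rw [Real.enorm_of_nonneg (by positivity), ← ENNReal.ofReal_rpow_of_pos hx0, ofReal_norm]

theorem exists_lintegral_ball_enorm_add_rpow_neg_le {E : Type*} [NormedAddCommGroup E]
    [NormedSpace ℝ E] [FiniteDimensional ℝ E] [MeasurableSpace E] [BorelSpace E] (μ : Measure E)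
    [μ.IsAddHaarMeasure] (hE : 1 ≤ Module.finrank ℝ E) {κ : ℝ} (hκ0 : 0 ≤ κ)
    (hκ : κ < Module.finrank ℝ E) (r : ℝ) :
    ∃ C : ENNReal, C ≠ ⊤ ∧
      ∀ x₀ : E, ∫⁻ x in Metric.ball (0 : E) r, ‖x₀ + x‖ₑ ^ (-κ) ∂μ ≤ C := by
  set g : E → ENNReal := (Metric.ball (0 : E) 1).indicator fun x => ‖x‖ₑ ^ (-κ) with hg
  have hgm : Measurable g := (by fun_prop : Measurable fun x : E => ‖x‖ₑ ^ (-κ)).indicator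
    measurableSet_ball
  refine ⟨μ (Metric.ball 0 r) + ∫⁻ x in Metric.ball (0 : E) 1, ‖x‖ₑ ^ (-κ) ∂μ,
    ENNReal.add_ne_top.2 ⟨measure_ball_lt_top.ne,
      lintegral_ball_enorm_rpow_neg_ne_top μ hE hκ 1⟩, fun x₀ => ?_⟩
  have hpt : ∀ x : E, ‖x₀ + x‖ₑ ^ (-κ) ≤ 1 + g (x₀ + x) := by
    intro x
    by_cases hx : x₀ + x ∈ Metric.ball (0 : E) 1
    · rw [hg, Set.indicator_of_mem hx]; exact le_add_self
    · refine le_trans ?_ le_self_add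
      rw [mem_ball_zero_iff, not_lt] at hx
      have h1 : 1 ≤ ‖x₀ + x‖ₑ := by
        rw [← ofReal_norm, ← ENNReal.ofReal_one]; exact ENNReal.ofReal_le_ofReal hx
      rw [ENNReal.rpow_neg, ENNReal.inv_le_one]
      simpa using ENNReal.rpow_le_rpow h1 hκ0
  calc ∫⁻ x in Metric.ball (0 : E) r, ‖x₀ + x‖ₑ ^ (-κ) ∂μ
      ≤ ∫⁻ x in Metric.ball (0 : E) r, (1 + g (x₀ + x)) ∂μ := lintegral_mono fun x => hpt x
    _ = μ (Metric.ball 0 r) + ∫⁻ x in Metric.ball (0 : E) r, g (x₀ + x) ∂μ := by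
        rw [lintegral_add_left measurable_const]; simp
    _ ≤ μ (Metric.ball 0 r) + ∫⁻ x, g (x₀ + x) ∂μ := by
        gcongr; exact Measure.restrict_le_self
    _ = _ := by
        rw [lintegral_add_left_eq_self g x₀, hg, lintegral_indicator measurableSet_ball]

namespace Heisenberg
variable {n : ℕ}

/-- The weight `|z|^(-β)` with values in `[0, ∞]`: unlike its real counterpart it is `∞`, not `0`,
on the center `z = 0` when `β > 0`. -/
def zWeight (β : ℝ) (ξ : Heisenberg n) : ENNReal := ENNReal.ofReal (zNorm ξ) ^ (-β)

@[fun_prop]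
theorem measurable_zWeight (β : ℝ) : Measurable (zWeight β : Heisenberg n → ENNReal) := by
  have := (continuous_zNorm (n := n)).measurable
  unfold zWeight; fun_prop

/-- Half of the power goes to each of `|x|` and `|y|`, so that the weight is dominated by a product
to which Tonelli's theorem applies; both factors are locally integrable when `β < 2n`. -/
theorem zWeight_le {β : ℝ} (hβ : 0 ≤ β) (ξ : Heisenberg n) :
    zWeight β ξ ≤ ‖ξ.1‖ₑ ^ (-(β / 2)) * ‖ξ.2.1‖ₑ ^ (-(β / 2)) := by
  have h1 : ‖ξ.1‖ₑ ≤ ENNReal.ofReal (zNorm ξ) := by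
    rw [← ofReal_norm]; exact ENNReal.ofReal_le_ofReal (norm_fst_le ξ)
  have h2 : ‖ξ.2.1‖ₑ ≤ ENNReal.ofReal (zNorm ξ) := by
    rw [← ofReal_norm]; exact ENNReal.ofReal_le_ofReal (norm_snd_fst_le ξ)
  have hz : zWeight β ξ =
      ENNReal.ofReal (zNorm ξ) ^ (-(β / 2)) * ENNReal.ofReal (zNorm ξ) ^ (-(β / 2)) := by
    rw [zWeight, ENNReal.rpow_neg, ENNReal.rpow_neg, ← ENNReal.mul_inv (Or.inr
      (ENNReal.rpow_ne_top_of_nonneg (by positivity) ENNReal.ofReal_ne_top))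
      (Or.inl (ENNReal.rpow_ne_top_of_nonneg (by positivity) ENNReal.ofReal_ne_top)),
      ← ENNReal.rpow_add_of_nonneg _ _ (by positivity) (by positivity), add_halves]
  rw [hz]
  have hβ2 : 0 ≤ β / 2 := by positivity
  simp only [ENNReal.rpow_neg]
  gcongr

/-- The measure `|z|^(-β) dξ` of a gauge ball decays at least quadratically in the radius,
uniformly in the center: the two horizontal factors are bounded by a translate of a locally
integrable power, and the fibre in the central variable has length `2r²`. -/
theorem exists_lintegral_gaugeBall_zWeight_le (hn : 1 ≤ n) {β : ℝ} (hβ0 : 0 ≤ β)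
    (hβ : β < 2 * n) (M : ℝ) :
    ∃ C : ENNReal, C ≠ ⊤ ∧ ∀ (η : Heisenberg n) (r : ℝ), 0 < r → r ≤ M →
      ∫⁻ ξ in gaugeBall η r, zWeight β ξ ≤ C * ENNReal.ofReal (r ^ 2) := by
  obtain ⟨C, hC, hCb⟩ := exists_lintegral_ball_enorm_add_rpow_neg_le
    (volume : Measure (EuclideanSpace ℝ (Fin n))) (by simpa using hn) (κ := β / 2) (by positivity)
    (by rw [finrank_euclideanSpace_fin]; linarith) M
  refine ⟨C * (C * 2), by finiteness, fun η r hr hrM => ?_⟩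
  have hpre : op η ⁻¹' gaugeBall η r = gaugeBall 0 r := by
    ext ζ; simp [gaugeBall, op_inverse_op, op_inverse_zero]
  rw [← (measurePreserving_op η).setLIntegral_comp_preimage (isOpen_gaugeBall η r).measurableSet
    (measurable_zWeight β), hpre]
  set F : EuclideanSpace ℝ (Fin n) → EuclideanSpace ℝ (Fin n) → ENNReal :=
    fun x₀ x => ‖x₀ + x‖ₑ ^ (-(β / 2)) with hF
  have hFm : ∀ x₀, Measurable (F x₀) := fun x₀ => by simp only [hF]; fun_prop
  calc ∫⁻ ζ in gaugeBall 0 r, zWeight β (op η ζ)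
      ≤ ∫⁻ ζ in gaugeBall 0 r, F η.1 ζ.1 * (F η.2.1 ζ.2.1 * 1) :=
        lintegral_mono fun ζ => by
          simpa only [mul_one, op] using zWeight_le hβ0 (op η ζ)
    _ ≤ ∫⁻ ζ in Metric.ball 0 r ×ˢ Metric.ball 0 r ×ˢ Metric.ball 0 (r ^ 2),
          F η.1 ζ.1 * (F η.2.1 ζ.2.1 * 1) := lintegral_mono_set (gaugeBall_zero_subset r)
    _ = (∫⁻ x in Metric.ball 0 r, F η.1 x) * ((∫⁻ y in Metric.ball 0 r, F η.2.1 y) *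
          ∫⁻ t in Metric.ball (0 : ℝ) (r ^ 2), 1) := by
        rw [Measure.volume_eq_prod, ← Measure.prod_restrict, Measure.volume_eq_prod,
          ← Measure.prod_restrict, lintegral_prod_mul (f := F η.1)
            (g := fun w : EuclideanSpace ℝ (Fin n) × ℝ => F η.2.1 w.1 * 1)
            (hFm _).aemeasurable (by fun_prop),
          lintegral_prod_mul (f := F η.2.1) (g := fun _ => 1) (hFm _).aemeasurable
            aemeasurable_const]
    _ ≤ C * (C * ENNReal.ofReal (2 * r ^ 2)) := by
        have hb : Metric.ball (0 : EuclideanSpace ℝ (Fin n)) r ⊆ Metric.ball 0 M :=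
          Metric.ball_subset_ball hrM
        gcongr
        · exact (lintegral_mono_set hb).trans (hCb _)
        · exact (lintegral_mono_set hb).trans (hCb _)
        · simp [Real.volume_ball]
    _ = _ := by
        rw [ENNReal.ofReal_mul (by norm_num)]; simp [mul_assoc]

end Heisenberg

/-! ### The fractional kernel at small scales -/

namespace Heisenberg
variable {n : ℕ}

/-- The integrand of the fractional seminorm, with `S` for `ps` and `κ` for `(p - 2)α`. -/
def kernel (p S κ : ℝ) (f : Heisenberg n → ℝ) (ξ η : Heisenberg n) : ENNReal :=
  ENNReal.ofReal (|f ξ - f η| ^ p /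
    (gauge (op (inverse ξ) η) ^ (homDim n + S) * zNorm (ξ - η) ^ κ))

variable {p S κ : ℝ} {f : Heisenberg n → ℝ}

theorem measurable_kernel (p S κ : ℝ) (hf : Measurable f) :
    Measurable (Function.uncurry (kernel p S κ f)) := by
  have h1 : Measurable fun x : Heisenberg n × Heisenberg n => gauge (op (inverse x.1) x.2) :=
    Continuous.measurable (by fun_prop)
  have h2 : Measurable fun x : Heisenberg n × Heisenberg n => zNorm (x.1 - x.2) :=
    Continuous.measurable (by fun_prop)
  have h3 : Measurable fun x : Heisenberg n × Heisenberg n => |f x.1 - f x.2| := by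
    have := (hf.comp measurable_fst).sub (hf.comp (measurable_snd (α := Heisenberg n)))
    exact this.abs
  exact ENNReal.measurable_ofReal.comp
    ((h3.pow_const p).div ((h1.pow_const _).mul (h2.pow_const _)))

theorem ae_fst_ne (hn : 1 ≤ n) (x : EuclideanSpace ℝ (Fin n)) :
    ∀ᵐ η : Heisenberg n, η.1 ≠ x := by
  have : Nontrivial (EuclideanSpace ℝ (Fin n)) :=
    Module.nontrivial_of_finrank_pos (R := ℝ) (by rw [finrank_euclideanSpace_fin]; omega)
  have h : (volume : Measure (Heisenberg n)) (({x} : Set (EuclideanSpace ℝ (Fin n))) ×ˢ Set.univ)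
      = 0 := by
    rw [Measure.volume_eq_prod, Measure.prod_prod, measure_singleton, zero_mul]
  filter_upwards [compl_mem_ae_iff.2 h] with η hη hx
  exact hη ⟨hx, trivial⟩

theorem homDim_pos : 0 < homDim n := by rw [homDim]; positivity

/-- The restriction to almost every `η` is needed: the kernel is `0`, by division by zero, at points
`η ≠ ξ` with the same horizontal part. -/
theorem ae_enorm_sub_rpow_le_kernel (hn : 1 ≤ n) (hp : 0 ≤ p) (hS : 0 ≤ S) (hκ : 0 ≤ κ)
    (f : Heisenberg n → ℝ) {r : ℝ} (ξ : Heisenberg n) :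
    ∀ᵐ η : Heisenberg n, gauge (op (inverse ξ) η) ≤ r →
      ‖f ξ - f η‖ₑ ^ p ≤ ENNReal.ofReal (r ^ (homDim n + S + κ)) * kernel p S κ f ξ η := by
  filter_upwards [ae_fst_ne hn ξ.1] with η hη hr
  have hQ := homDim_pos (n := n)
  have hz : 0 < zNorm (ξ - η) :=
    (norm_pos_iff.2 (sub_ne_zero.2 hη.symm)).trans_le (norm_fst_le (ξ - η))
  have hzd := zNorm_sub_le_gauge ξ η
  have hd : 0 < gauge (op (inverse ξ) η) := hz.trans_le hzd
  have hr0 : 0 < r := hd.trans_le hr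
  rw [kernel, ← ENNReal.ofReal_mul (by positivity), ← ofReal_norm, Real.norm_eq_abs,
    ENNReal.ofReal_rpow_of_nonneg (abs_nonneg _) hp]
  apply ENNReal.ofReal_le_ofReal
  rw [mul_div_assoc', le_div_iff₀ (by positivity), mul_comm]
  have : gauge (op (inverse ξ) η) ^ (homDim n + S) * zNorm (ξ - η) ^ κ ≤
      r ^ (homDim n + S + κ) := by
    rw [Real.rpow_add hr0]
    have := hzd.trans hr
    gcongr
  gcongr

theorem lintegral_lintegral_enorm_sub_rpow_le (hn : 1 ≤ n) (hp : 0 ≤ p) (hS : 0 ≤ S) (hκ : 0 ≤ κ)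
    (f : Heisenberg n → ℝ) {r : ℝ} {s t : Set (Heisenberg n)} (hs : MeasurableSet s)
    (ht : MeasurableSet t) (hst : ∀ ξ ∈ s, ∀ η ∈ t, gauge (op (inverse ξ) η) ≤ r) :
    ∫⁻ ξ in s, ∫⁻ η in t, ‖f ξ - f η‖ₑ ^ p ≤
      ENNReal.ofReal (r ^ (homDim n + S + κ)) * ∫⁻ ξ in s, ∫⁻ η in t, kernel p S κ f ξ η := by
  rw [← lintegral_const_mul' _ _ ENNReal.ofReal_ne_top]
  refine setLIntegral_mono' hs fun ξ hξ => ?_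
  rw [← lintegral_const_mul' _ _ ENNReal.ofReal_ne_top]
  refine lintegral_mono_ae ?_
  filter_upwards [ae_restrict_of_ae (ae_enorm_sub_rpow_le_kernel (r := r) hn hp hS hκ f ξ),
    ae_restrict_mem ht] with η h1 h2
  exact h1 (hst ξ hξ η h2)

theorem op_op_inverse (ξ η : Heisenberg n) : op ξ (op (inverse ξ) η) = η := by
  ext1
  · simp [op, inverse]
  · ext1
    · simp [op, inverse]
    · simp only [op, inverse, inner_neg_left, inner_add_right, inner_neg_right]
      rw [real_inner_comm ξ.1 ξ.2.1]; ring

theorem exists_gaugeBall_enorm_sub_le (hf : Continuous f) (ξ : Heisenberg n) {ε : ℝ} (hε : 0 < ε) :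
    ∃ δ > 0, ∀ r ≤ δ, ∀ η ∈ gaugeBall ξ r, ‖f ξ - f η‖ₑ ≤ ENNReal.ofReal ε := by
  have hc : Continuous fun ζ => f (op ξ ζ) := by fun_prop
  obtain ⟨δ, hδ, h⟩ := Metric.continuous_iff.1 hc 0 ε hε
  refine ⟨min δ 1, by positivity, fun r hr η hη => ?_⟩
  have hg : gauge (op (inverse ξ) η) < r := hη
  have h0 := gauge_nonneg (op (inverse ξ) η)
  have hrδ : r ≤ δ := hr.trans (min_le_left _ _)
  have hr1 : r ≤ 1 := hr.trans (min_le_right _ _)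
  set ζ := op (inverse ξ) η with hζ
  have hdist : dist ζ 0 < δ := by
    have h1 : ‖ζ.1‖ < δ := ((norm_fst_le ζ).trans (zNorm_le_gauge ζ)).trans_lt (hg.trans_le hrδ)
    have h2 : ‖ζ.2.1‖ < δ :=
      ((norm_snd_fst_le ζ).trans (zNorm_le_gauge ζ)).trans_lt (hg.trans_le hrδ)
    have h3 : |ζ.2.2| < δ := lt_of_le_of_lt (abs_snd_snd_le ζ) (by nlinarith)
    rw [dist_zero_right, Prod.norm_def, Prod.norm_def]
    simp [h1, h2, h3]
  have := h ζ hdist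
  rw [hζ, op_op_inverse] at this
  have hz : op ξ 0 = ξ := by simp [op]
  rw [hz, dist_comm, Real.dist_eq] at this
  rw [← ofReal_norm, Real.norm_eq_abs]
  exact ENNReal.ofReal_le_ofReal this.le

theorem gaugeBall_subset_shell {ξ : Heisenberg n} (hξ : ξ ∈ shell (n := n) 1 2) {r : ℝ}
    (hr : r ≤ 1 / 4) : gaugeBall ξ r ⊆ shell (1 / 4) 8 := by
  intro η hη
  have hd : gauge (op (inverse ξ) η) < r := hη
  have h1 : gauge (op (inverse 0) ξ) ≤ 2 := by rw [op_inverse_zero]; exact hξ.2.le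
  have h2 := gauge_triangle h1 (hd.le.trans (hr.trans (by norm_num)))
  rw [op_inverse_zero] at h2
  refine ⟨?_, by linarith⟩
  by_contra! hlt
  have h3 : gauge (op (inverse 0) η) ≤ 1 / 4 := by rw [op_inverse_zero]; exact hlt.le
  have h4 := gauge_triangle h3 (ζ := ξ) (by rw [gauge_op_comm]; exact hd.le.trans hr)
  rw [op_inverse_zero] at h4
  have := hξ.1
  linarith

theorem gauge_le_of_mem_shell {ξ η : Heisenberg n} {a b : ℝ} (hξ : ξ ∈ shell (n := n) a b)
    (hη : η ∈ shell (n := n) a b) : gauge (op (inverse ξ) η) ≤ 3 * b :=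
  gauge_op_le (by rw [gauge_inverse]; exact hξ.2.le) hη.2.le

/-- The normalizing factor relating averages over concentric gauge balls to the seminorm stays
bounded at small scales exactly because `S + κ ≥ Q`. -/
theorem exists_inv_volume_gaugeBall_le (hSκ : homDim n ≤ S + κ) :
    ∃ C : ENNReal, C ≠ ⊤ ∧ ∀ (ξ : Heisenberg n) (r : ℝ), 0 < r → r ≤ 1 →
      (volume (gaugeBall ξ r))⁻¹ * (volume (gaugeBall ξ (r / 2)))⁻¹ *
        ENNReal.ofReal ((3 * r) ^ (homDim n + S + κ)) ≤ C := by
  set v := volume (gaugeBall (0 : Heisenberg n) 1) with hv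
  have hv0 : v ≠ 0 := volume_gaugeBall_ne_zero 0 one_pos
  have hvt : v ≠ ⊤ := volume_gaugeBall_ne_top 0 1
  have hQ := homDim_pos (n := n)
  refine ⟨v⁻¹ * v⁻¹ * ENNReal.ofReal (2 ^ homDim n * 3 ^ (homDim n + S + κ)), by finiteness,
    fun ξ r hr hr1 => ?_⟩
  have hinv : ∀ ρ : ℝ, 0 < ρ → (volume (gaugeBall ξ ρ))⁻¹ =
      ENNReal.ofReal (ρ ^ (-homDim n)) * v⁻¹ := fun ρ hρ => by
    rw [volume_gaugeBall, volume_gaugeBall_zero hρ, ENNReal.mul_inv (Or.inr hvt)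
      (Or.inl ENNReal.ofReal_ne_top), ← ENNReal.ofReal_inv_of_pos (by positivity),
      Real.rpow_neg hρ.le]
  rw [hinv r hr, hinv (r / 2) (by positivity)]
  calc _ = v⁻¹ * v⁻¹ * (ENNReal.ofReal (r ^ (-homDim n)) * ENNReal.ofReal ((r / 2) ^ (-homDim n)) *
        ENNReal.ofReal ((3 * r) ^ (homDim n + S + κ))) := by ring
    _ ≤ _ := by
      rw [← ENNReal.ofReal_mul (by positivity), ← ENNReal.ofReal_mul (by positivity)]
      refine mul_le_mul' le_rfl (ENNReal.ofReal_le_ofReal ?_)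
      rw [Real.div_rpow hr.le (by norm_num), Real.mul_rpow (by norm_num) hr.le,
        Real.rpow_neg (by norm_num : (0 : ℝ) ≤ 2), div_inv_eq_mul]
      calc _ = 2 ^ homDim n * 3 ^ (homDim n + S + κ) *
            (r ^ (-homDim n) * r ^ (-homDim n) * r ^ (homDim n + S + κ)) := by ring
        _ ≤ 2 ^ homDim n * 3 ^ (homDim n + S + κ) * 1 := by
          gcongr
          rw [← Real.rpow_add hr, ← Real.rpow_add hr]
          exact Real.rpow_le_one hr.le hr1 (by linarith)
        _ = _ := mul_one _

end Heisenberg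

/-! ### Averages over shrinking balls -/

namespace Heisenberg
variable {n : ℕ} {p S κ : ℝ}

/-- The energy `∫∫_{D × D}` of `f` on the unit-scale shell `D = {1/4 ≤ d < 8}`. -/
def shellEnergy (p S κ : ℝ) (f : Heisenberg n → ℝ) : ENNReal :=
  ∫⁻ ξ in shell (1 / 4) 8, ∫⁻ η in shell (1 / 4) 8, kernel p S κ f ξ η

/-- The sets over which a function is averaged to approach its value at `ξ`: the whole shell
`{1 ≤ d < 2}`, then gauge balls around `ξ` with radii `2^(-k-2)`. -/
def avgSet (ξ : Heisenberg n) : ℕ → Set (Heisenberg n)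
  | 0 => shell 1 2
  | k + 1 => gaugeBall ξ (1 / 4 * (1 / 2) ^ k)

theorem volume_avgSet_ne_zero (ξ : Heisenberg n) (k : ℕ) : volume (avgSet ξ k) ≠ 0 := by
  cases k with
  | zero => exact volume_shell_ne_zero (by norm_num) (by norm_num)
  | succ k => exact volume_gaugeBall_ne_zero ξ (by positivity)

theorem volume_avgSet_ne_top (ξ : Heisenberg n) (k : ℕ) : volume (avgSet ξ k) ≠ ⊤ := by
  cases k with
  | zero => exact volume_shell_ne_top 1 2
  | succ k => exact volume_gaugeBall_ne_top ξ _

theorem shell_subset_shell {a b a' b' : ℝ} (ha : a' ≤ a) (hb : b ≤ b') :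
    (shell a b : Set (Heisenberg n)) ⊆ shell a' b' :=
  fun _ h => ⟨ha.trans h.1, h.2.trans_le hb⟩

theorem gaugeBall_mono (ξ : Heisenberg n) {r r' : ℝ} (h : r ≤ r') :
    gaugeBall ξ r ⊆ gaugeBall ξ r' := fun _ hη => lt_of_lt_of_le hη h

/-- Averages over subsets of the shell `{1/4 ≤ d < 8}` differ by at most the energy. -/
theorem enorm_setAverage_sub_le_shellEnergy (hn : 1 ≤ n) (hp : 1 ≤ p) (hS : 0 ≤ S) (hκ : 0 ≤ κ)
    {f : Heisenberg n → ℝ} (hf : Integrable f) {s t : Set (Heisenberg n)}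
    (hs : MeasurableSet s) (ht : MeasurableSet t) (hsD : s ⊆ shell (1 / 4) 8)
    (htD : t ⊆ shell (1 / 4) 8) (hs0 : volume s ≠ 0) (ht0 : volume t ≠ 0) :
    ‖(⨍ x in s, f x) - ⨍ x in t, f x‖ₑ ^ p ≤
      (volume s)⁻¹ * (volume t)⁻¹ * ENNReal.ofReal (24 ^ (homDim n + S + κ)) *
        shellEnergy p S κ f := by
  have hst : ∀ u : Set (Heisenberg n), u ⊆ shell (1 / 4) 8 → volume u ≠ ⊤ := fun u hu =>
    ((measure_mono hu).trans_lt (volume_shell_ne_top _ _).lt_top).ne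
  refine (enorm_setAverage_sub_setAverage_rpow_le hp hs0 (hst s hsD) ht0 (hst t htD) hf).trans ?_
  rw [mul_assoc _ (ENNReal.ofReal _)]
  gcongr
  refine (lintegral_lintegral_enorm_sub_rpow_le (r := 24) hn (by linarith) hS hκ f hs ht
    fun ξ hξ η hη => ?_).trans ?_
  · have := gauge_le_of_mem_shell (hsD hξ) (htD hη)
    linarith
  · gcongr
    exact (lintegral_mono fun _ => lintegral_mono_set htD).trans (lintegral_mono_set hsD)

/-- The single-step bound in the telescoping sum of averages: at the scale `r` the difference of
consecutive averages is controlled by the part of the energy carried by the ball of radius `r`. -/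
theorem enorm_setAverage_gaugeBall_sub_le (hn : 1 ≤ n) (hp : 1 ≤ p) (hS : 0 ≤ S) (hκ : 0 ≤ κ)
    {f : Heisenberg n → ℝ} (hf : Integrable f) {ξ : Heisenberg n} (hξ : ξ ∈ shell (n := n) 1 2)
    {r : ℝ} (hr0 : 0 < r) (hr : r ≤ 1 / 4) :
    ‖(⨍ x in gaugeBall ξ r, f x) - ⨍ x in gaugeBall ξ (r / 2), f x‖ₑ ^ p ≤
      (volume (gaugeBall ξ r))⁻¹ * (volume (gaugeBall ξ (r / 2)))⁻¹ *
        ENNReal.ofReal ((3 * r) ^ (homDim n + S + κ)) *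
        ∫⁻ η in gaugeBall ξ r, ∫⁻ ζ in shell (1 / 4) 8, kernel p S κ f η ζ := by
  refine (enorm_setAverage_sub_setAverage_rpow_le hp (volume_gaugeBall_ne_zero ξ hr0)
    (volume_gaugeBall_ne_top ξ r) (volume_gaugeBall_ne_zero ξ (by positivity))
    (volume_gaugeBall_ne_top ξ _) hf).trans ?_
  rw [mul_assoc _ (ENNReal.ofReal _)]
  gcongr
  refine (lintegral_lintegral_enorm_sub_rpow_le (r := 3 * r) hn (by linarith) hS hκ f
    (isOpen_gaugeBall ξ r).measurableSet (isOpen_gaugeBall ξ _).measurableSet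
    fun η hη ζ hζ => ?_).trans ?_
  · refine gauge_triangle (η := ξ) ?_ ?_
    · rw [gauge_op_comm]; exact le_of_lt hη
    · have : gauge (op (inverse ξ) ζ) < r / 2 := hζ
      linarith
  · exact mul_le_mul' le_rfl (lintegral_mono fun _ => lintegral_mono_set
      ((gaugeBall_mono ξ (by linarith)).trans (gaugeBall_subset_shell hξ hr)))

theorem exists_enorm_sub_setAverage_avgSet_le {f : Heisenberg n → ℝ} (hc : Continuous f)
    (hf : Integrable f) (ξ : Heisenberg n) {ε : ℝ} (hε : 0 < ε) :
    ∃ N, ‖f ξ - ⨍ x in avgSet ξ N, f x‖ₑ ≤ ENNReal.ofReal ε := by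
  obtain ⟨δ, hδ, h⟩ := exists_gaugeBall_enorm_sub_le hc ξ hε
  obtain ⟨k, hk⟩ := exists_pow_lt_of_lt_one hδ (by norm_num : (1 / 2 : ℝ) < 1)
  refine ⟨k + 1, ?_⟩
  have hv0 := volume_avgSet_ne_zero ξ (k + 1)
  have hvt := volume_avgSet_ne_top ξ (k + 1)
  have h1 := enorm_sub_setAverage_rpow_le (p := 1) le_rfl (f ξ) hv0 hvt hf
  simp only [ENNReal.rpow_one] at h1
  have hpow : (0 : ℝ) < (1 / 2) ^ k := by positivity
  calc _ ≤ _ := h1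
    _ ≤ (volume (avgSet ξ (k + 1)))⁻¹ * ∫⁻ _ in avgSet ξ (k + 1), ENNReal.ofReal ε := by
      gcongr _ * ?_
      exact setLIntegral_mono' (isOpen_gaugeBall ξ _).measurableSet fun η hη =>
        h (1 / 4 * (1 / 2) ^ k) (by linarith) η hη
    _ = _ := by
      rw [setLIntegral_const, mul_comm (ENNReal.ofReal ε), ← mul_assoc,
        ENNReal.inv_mul_cancel hv0 hvt, one_mul]

/-- A continuous function minus its mean over the unit shell, as a telescoping sum of averages. -/
theorem enorm_sub_setAverage_le_tsum {f : Heisenberg n → ℝ} (hc : Continuous f)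
    (hf : Integrable f) (ξ : Heisenberg n) :
    ‖f ξ - ⨍ x in shell 1 2, f x‖ₑ ≤
      ∑' k, ‖(⨍ x in avgSet ξ k, f x) - ⨍ x in avgSet ξ (k + 1), f x‖ₑ := by
  refine ENNReal.le_of_forall_pos_le_add fun ε hε _ => ?_
  obtain ⟨N, hN⟩ := exists_enorm_sub_setAverage_avgSet_le hc hf ξ (NNReal.coe_pos.2 hε)
  rw [ENNReal.ofReal_coe_nnreal] at hN
  set m : ℕ → ℝ := fun k => ⨍ x in avgSet ξ k, f x with hm
  have h1 : edist (m 0) (m N) ≤ ∑ k ∈ Finset.range N, edist (m k) (m (k + 1)) :=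
    edist_le_range_sum_edist m N
  calc ‖f ξ - m 0‖ₑ = edist (f ξ) (m 0) := (edist_eq_enorm_sub _ _).symm
    _ ≤ edist (m N) (m 0) + edist (f ξ) (m N) := by
        rw [add_comm]; exact edist_triangle _ _ _
    _ ≤ (∑ k ∈ Finset.range N, edist (m k) (m (k + 1))) + ε := by
        gcongr
        · rw [edist_comm]; exact h1
        · rw [edist_eq_enorm_sub]; exact hN
    _ ≤ (∑' k, edist (m k) (m (k + 1))) + ε := by
        gcongr; exact ENNReal.sum_le_tsum _
    _ = _ := by simp only [edist_eq_enorm_sub, hm]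

end Heisenberg

/-! ### Weighted embedding on the unit shell -/

namespace Heisenberg
variable {n : ℕ} {p S κ : ℝ}

/-- The part of `∫ G` over the shell `{1/4 ≤ d < 8}` carried by the gauge ball of radius `r`
around `ξ`. -/
def localMass (G : Heisenberg n → ENNReal) (r : ℝ) (ξ : Heisenberg n) : ENNReal :=
  ∫⁻ η in shell (1 / 4) 8, {x : Heisenberg n × Heisenberg n |
    gauge (op (inverse x.1) x.2) < r}.indicator (fun x => G x.2) (ξ, η)

theorem measurableSet_gauge_lt (r : ℝ) :
    MeasurableSet {x : Heisenberg n × Heisenberg n | gauge (op (inverse x.1) x.2) < r} :=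
  (isOpen_lt (by fun_prop) continuous_const).measurableSet

variable {G : Heisenberg n → ENNReal}

theorem measurable_localMass (hG : Measurable G) (r : ℝ) : Measurable (localMass G r) :=
  Measurable.lintegral_prod_right'
    ((hG.comp measurable_snd).indicator (measurableSet_gauge_lt r))

theorem localMass_le (r : ℝ) (ξ : Heisenberg n) :
    localMass G r ξ ≤ ∫⁻ η in shell (1 / 4) 8, G η :=
  lintegral_mono fun η => Set.indicator_le_self' (fun _ _ => zero_le) (ξ, η)

theorem lintegral_gaugeBall_le_localMass {ξ : Heisenberg n} (hξ : ξ ∈ shell (n := n) 1 2) {r : ℝ}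
    (hr : r ≤ 1 / 4) : ∫⁻ η in gaugeBall ξ r, G η ≤ localMass G r ξ := by
  have hind : (fun η => {x : Heisenberg n × Heisenberg n |
      gauge (op (inverse x.1) x.2) < r}.indicator (fun x => G x.2) (ξ, η)) =
      (gaugeBall ξ r).indicator G := by
    ext η
    by_cases h : gauge (op (inverse ξ) η) < r <;> simp [Set.indicator, gaugeBall, h]
  rw [localMass, hind, setLIntegral_indicator (isOpen_gaugeBall ξ r).measurableSet,
    Set.inter_eq_left.2 (gaugeBall_subset_shell hξ hr)]

/-- Exchanging the order of integration moves the weight onto a gauge ball. -/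
theorem lintegral_zWeight_mul_localMass_le (hG : Measurable G) {β : ℝ} {r : ℝ} {C : ENNReal}
    (hC : ∀ η : Heisenberg n, ∫⁻ ξ in gaugeBall η r, zWeight β ξ ≤ C) :
    ∫⁻ ξ in shell 1 2, zWeight β ξ * localMass G r ξ ≤ C * ∫⁻ η in shell (1 / 4) 8, G η := by
  set P : Set (Heisenberg n × Heisenberg n) := {x | gauge (op (inverse x.1) x.2) < r} with hP
  have hPm : MeasurableSet P := measurableSet_gauge_lt r
  have hΦ : Measurable fun x : Heisenberg n × Heisenberg n =>
      P.indicator (fun x => G x.2) x := (hG.comp measurable_snd).indicator hPm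
  have hw := measurable_zWeight (n := n) β
  calc ∫⁻ ξ in shell 1 2, zWeight β ξ * localMass G r ξ
      = ∫⁻ ξ in shell 1 2, ∫⁻ η in shell (1 / 4) 8,
          zWeight β ξ * P.indicator (fun x => G x.2) (ξ, η) := by
        refine lintegral_congr fun ξ => ?_
        exact (lintegral_const_mul _ (hΦ.comp measurable_prodMk_left)).symm
    _ = ∫⁻ η in shell (1 / 4) 8, ∫⁻ ξ in shell 1 2,
          zWeight β ξ * P.indicator (fun x => G x.2) (ξ, η) :=
        lintegral_lintegral_swap ((hw.comp measurable_fst).mul hΦ).aemeasurable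
    _ ≤ ∫⁻ η in shell (1 / 4) 8, C * G η := by
        refine lintegral_mono fun η => ?_
        have hpt : ∀ ξ, zWeight β ξ * P.indicator (fun x => G x.2) (ξ, η) =
            (gaugeBall η r).indicator (zWeight β) ξ * G η := by
          intro ξ
          have hmem : (ξ, η) ∈ P ↔ ξ ∈ gaugeBall η r := by
            simp only [hP, gaugeBall, Set.mem_ofPred_eq]
            rw [gauge_op_comm]
          by_cases h : ξ ∈ gaugeBall η r
          · rw [Set.indicator_of_mem h, Set.indicator_of_mem (hmem.2 h)]
          · rw [Set.indicator_of_notMem h, Set.indicator_of_notMem (fun h' => h (hmem.1 h'))]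
            simp
        calc ∫⁻ ξ in shell 1 2, zWeight β ξ * P.indicator (fun x => G x.2) (ξ, η)
            ≤ ∫⁻ ξ, (gaugeBall η r).indicator (zWeight β) ξ * G η := by
              simp only [hpt]; exact setLIntegral_le_lintegral _ _
          _ = (∫⁻ ξ in gaugeBall η r, zWeight β ξ) * G η := by
              rw [lintegral_mul_const _ (hw.indicator (isOpen_gaugeBall η r).measurableSet),
                lintegral_indicator (isOpen_gaugeBall η r).measurableSet]
          _ ≤ C * G η := by gcongr; exact hC η
    _ = _ := lintegral_const_mul _ hG

theorem tsum_two_pow_mul_sq_ne_top :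
    ∑' k : ℕ, (2 : ENNReal) ^ (k + 1) * ENNReal.ofReal ((1 / 4 * (1 / 2) ^ k) ^ 2) ≠ ⊤ := by
  have hk : ∀ k : ℕ, (2 : ENNReal) ^ (k + 1) * ENNReal.ofReal ((1 / 4 * (1 / 2) ^ k) ^ 2) =
      ENNReal.ofReal (1 / 8) * ENNReal.ofReal (1 / 2) ^ k := by
    intro k
    rw [← ENNReal.ofReal_pow (by norm_num), ← ENNReal.ofReal_mul (by norm_num),
      show (2 : ENNReal) = ENNReal.ofReal 2 by simp, ← ENNReal.ofReal_pow (by norm_num),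
      ← ENNReal.ofReal_mul (by positivity)]
    congr 1
    have : (2 : ℝ) ^ k * (1 / 2) ^ k = 1 := by rw [← mul_pow]; norm_num
    calc (2 : ℝ) ^ (k + 1) * (1 / 4 * (1 / 2) ^ k) ^ 2 =
        1 / 8 * ((2 : ℝ) ^ k * (1 / 2) ^ k) * (1 / 2) ^ k := by ring
      _ = _ := by rw [this]; ring
  simp only [hk, ENNReal.tsum_mul_left, ENNReal.tsum_geometric]
  refine ENNReal.mul_ne_top ENNReal.ofReal_ne_top (ENNReal.inv_ne_top.2 (tsub_pos_of_lt ?_).ne')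
  rw [← ENNReal.ofReal_one]
  exact (ENNReal.ofReal_lt_ofReal_iff one_pos).2 (by norm_num)

/-- Weighted Sobolev-type embedding on a shell, in the critical or subcritical range `S + κ ≥ Q`:
the energy controls every `L^σ` norm with `σ ≥ p`. The function minus its average is a sum of
differences of averages over shrinking balls; the `k`-th difference is bounded pointwise by the
energy in the ball of radius `2^(-k-2)`, and its integral decays geometrically because the
weighted measure of these balls does. -/
theorem exists_lintegral_zWeight_mul_enorm_sub_rpow_le (hn : 1 ≤ n) (hp : 1 < p) (hS : 0 ≤ S)
    (hκ : 0 ≤ κ) (hSκ : homDim n ≤ S + κ) {β : ℝ} (hβ0 : 0 ≤ β) (hβ : β < 2 * n) {σ : ℝ}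
    (hσ : p ≤ σ) :
    ∃ C : ENNReal, C ≠ ⊤ ∧ ∀ f : Heisenberg n → ℝ, Continuous f → Integrable f →
      ∫⁻ ξ in shell 1 2, zWeight β ξ * ‖f ξ - ⨍ x in shell 1 2, f x‖ₑ ^ σ ≤
        C * shellEnergy p S κ f ^ (σ / p) := by
  obtain ⟨CW, hCW, hW⟩ := exists_lintegral_gaugeBall_zWeight_le hn hβ0 hβ 2
  obtain ⟨C1, hC1, hstep⟩ := exists_inv_volume_gaugeBall_le (n := n) hSκ
  obtain ⟨Cσ, hCσ, hsum⟩ := ENNReal.exists_tsum_rpow_le (hp.trans_le hσ)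
  have hp0 : 0 < p := by linarith
  have hσ0 : 0 < σ := by linarith
  have hθ : 1 ≤ σ / p := (one_le_div hp0).2 hσ
  set θ := σ / p with hθdef
  have hpow : ∀ t : ENNReal, t ^ σ = (t ^ p) ^ θ := fun t => by
    rw [← ENNReal.rpow_mul, hθdef, mul_div_cancel₀ _ hp0.ne']
  set v := volume (shell 1 2 : Set (Heisenberg n)) with hv
  set v' := volume (gaugeBall (0 : Heisenberg n) (1 / 4)) with hv'
  set C0 : ENNReal := v⁻¹ * v'⁻¹ * ENNReal.ofReal (24 ^ (homDim n + S + κ)) with hC0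
  have hv0 : v ≠ 0 := volume_shell_ne_zero (by norm_num) (by norm_num)
  have hv0' : v' ≠ 0 := volume_gaugeBall_ne_zero 0 (by norm_num)
  have hC0t : C0 ≠ ⊤ := by rw [hC0]; finiteness
  set T₀ : ENNReal :=
    ∑' k : ℕ, (2 : ENNReal) ^ (k + 1) * ENNReal.ofReal ((1 / 4 * (1 / 2) ^ k) ^ 2) with hT₀
  have hθ0 : 0 ≤ θ := by linarith
  have hθ1 : 0 ≤ θ - 1 := by linarith
  refine ⟨Cσ * (CW * ENNReal.ofReal (2 ^ 2) * C0 ^ θ + C1 ^ θ * (CW * T₀)), ?_,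
    fun f hc hf => ?_⟩
  · have := tsum_two_pow_mul_sq_ne_top
    have h1 : C0 ^ θ ≠ ⊤ := ENNReal.rpow_ne_top_of_nonneg hθ0 hC0t
    have h2 : C1 ^ θ ≠ ⊤ := ENNReal.rpow_ne_top_of_nonneg hθ0 hC1
    finiteness
  set E := shellEnergy p S κ f with hE
  set G : Heisenberg n → ENNReal := fun η => ∫⁻ ζ in shell (1 / 4) 8, kernel p S κ f η ζ with hGdef
  have hG : Measurable G := (measurable_kernel p S κ hc.measurable).lintegral_prod_right'
  set r : ℕ → ℝ := fun k => 1 / 4 * (1 / 2) ^ k with hr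
  have hr0 : ∀ k, 0 < r k := fun k => by simp only [hr]; positivity
  have hr4 : ∀ k, r k ≤ 1 / 4 := fun k => by
    have : (1 / 2 : ℝ) ^ k ≤ 1 := pow_le_one₀ (by norm_num) (by norm_num)
    simp only [hr]; linarith
  set a : Heisenberg n → ℕ → ENNReal := fun ξ k =>
    ‖(⨍ x in avgSet ξ k, f x) - ⨍ x in avgSet ξ (k + 1), f x‖ₑ with ha
  have ha0 : ∀ ξ ∈ shell (n := n) 1 2, a ξ 0 ^ σ ≤ C0 ^ θ * E ^ θ := by
    intro ξ hξ
    rw [hpow, ← ENNReal.mul_rpow_of_nonneg _ _ hθ0]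
    refine ENNReal.rpow_le_rpow ?_ hθ0
    have := enorm_setAverage_sub_le_shellEnergy hn hp.le hS hκ hf (measurableSet_shell 1 2)
      (isOpen_gaugeBall ξ (1 / 4)).measurableSet
      (shell_subset_shell (by norm_num) (by norm_num)) (gaugeBall_subset_shell hξ le_rfl) hv0
      (volume_gaugeBall_ne_zero ξ (by norm_num))
    rw [volume_gaugeBall] at this
    have h14 : avgSet ξ (0 + 1) = gaugeBall ξ (1 / 4) := by simp [avgSet]
    simp only [ha, h14]
    exact this
  have ha1 : ∀ ξ ∈ shell (n := n) 1 2, ∀ k,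
      a ξ (k + 1) ^ σ ≤ C1 ^ θ * (E ^ (θ - 1) * localMass G (r k) ξ) := by
    intro ξ hξ k
    have hhalf : r k / 2 = 1 / 4 * (1 / 2) ^ (k + 1) := by simp only [hr]; ring
    have h1 : a ξ (k + 1) ^ p ≤ C1 * localMass G (r k) ξ := by
      have := enorm_setAverage_gaugeBall_sub_le hn hp.le hS hκ hf hξ (hr0 k) (hr4 k)
      rw [hhalf] at this
      refine this.trans ?_
      rw [← hhalf]
      gcongr
      · exact hstep ξ (r k) (hr0 k) ((hr4 k).trans (by norm_num))
      · exact lintegral_gaugeBall_le_localMass hξ (hr4 k)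
    calc a ξ (k + 1) ^ σ ≤ (C1 * localMass G (r k) ξ) ^ θ := by
          rw [hpow]; exact ENNReal.rpow_le_rpow h1 hθ0
      _ = C1 ^ θ * (localMass G (r k) ξ ^ (θ - 1) * localMass G (r k) ξ) := by
          rw [ENNReal.mul_rpow_of_nonneg _ _ hθ0]
          congr 1
          conv_rhs => rw [← ENNReal.rpow_one (localMass G (r k) ξ), ← ENNReal.rpow_mul, one_mul]
          rw [← ENNReal.rpow_add_of_nonneg _ _ hθ1 zero_le_one, sub_add_cancel]
      _ ≤ _ := by
          have : localMass G (r k) ξ ≤ E := localMass_le _ _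
          gcongr
  have hw := measurable_zWeight (n := n) β
  calc ∫⁻ ξ in shell 1 2, zWeight β ξ * ‖f ξ - ⨍ x in shell 1 2, f x‖ₑ ^ σ
      ≤ ∫⁻ ξ in shell 1 2, Cσ * (zWeight β ξ * (C0 ^ θ * E ^ θ) +
          ∑' k : ℕ, 2 ^ (k + 1) * (C1 ^ θ * E ^ (θ - 1)) *
            (zWeight β ξ * localMass G (r k) ξ)) := by
        refine setLIntegral_mono' (measurableSet_shell 1 2) fun ξ hξ => ?_
        calc zWeight β ξ * ‖f ξ - ⨍ x in shell 1 2, f x‖ₑ ^ σ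
            ≤ zWeight β ξ * (Cσ * ∑' k, 2 ^ k * a ξ k ^ σ) := by
              gcongr
              refine le_trans ?_ (hsum (a ξ))
              exact ENNReal.rpow_le_rpow (enorm_sub_setAverage_le_tsum hc hf ξ) hσ0.le
          _ = Cσ * (zWeight β ξ * (a ξ 0 ^ σ + ∑' k, 2 ^ (k + 1) * a ξ (k + 1) ^ σ)) := by
              rw [tsum_eq_zero_add' ENNReal.summable, pow_zero, one_mul]; ring
          _ ≤ Cσ * (zWeight β ξ * (C0 ^ θ * E ^ θ + ∑' k, 2 ^ (k + 1) *
                (C1 ^ θ * (E ^ (θ - 1) * localMass G (r k) ξ)))) := by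
              gcongr with k
              · exact ha0 ξ hξ
              · exact ha1 ξ hξ k
          _ = _ := by
              rw [mul_add, ← ENNReal.tsum_mul_left]
              congr 3
              ext k; ring
    _ = Cσ * ((∫⁻ ξ in shell 1 2, zWeight β ξ) * (C0 ^ θ * E ^ θ) +
          ∑' k : ℕ, 2 ^ (k + 1) * (C1 ^ θ * E ^ (θ - 1)) *
            ∫⁻ ξ in shell 1 2, zWeight β ξ * localMass G (r k) ξ) := by
        have hwm : ∀ k, Measurable fun ξ => zWeight β ξ * localMass G (r k) ξ := fun k =>
          hw.mul (measurable_localMass hG _)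
        rw [lintegral_const_mul' _ _ hCσ, lintegral_add_left (by fun_prop),
          lintegral_mul_const _ hw, lintegral_tsum fun k => ((hwm k).const_mul _).aemeasurable]
        congr 3
        ext k
        rw [lintegral_const_mul _ (hwm k)]
    _ ≤ Cσ * ((CW * ENNReal.ofReal (2 ^ 2)) * (C0 ^ θ * E ^ θ) +
          ∑' k : ℕ, 2 ^ (k + 1) * (C1 ^ θ * E ^ (θ - 1)) *
            (CW * ENNReal.ofReal (r k ^ 2) * E)) := by
        gcongr with k
        · exact (lintegral_mono_set (shell_subset_gaugeBall 1 2)).trans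
            (hW 0 2 two_pos le_rfl)
        · exact lintegral_zWeight_mul_localMass_le hG fun η => hW η (r k) (hr0 k)
            ((hr4 k).trans (by norm_num))
    _ = _ := by
        have hEθ : E ^ θ = E ^ (θ - 1) * E := by
          conv_rhs => rw [← ENNReal.rpow_one E, ← ENNReal.rpow_mul, one_mul]
          rw [← ENNReal.rpow_add_of_nonneg _ _ hθ1 zero_le_one, sub_add_cancel]
        have hser : ∑' k : ℕ, 2 ^ (k + 1) * (C1 ^ θ * E ^ (θ - 1)) *
            (CW * ENNReal.ofReal (r k ^ 2) * E) = C1 ^ θ * E ^ θ * CW * T₀ := by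
          rw [hT₀, ← ENNReal.tsum_mul_left]
          refine tsum_congr fun k => ?_
          rw [hEθ]; ring
        rw [hser]; ring

end Heisenberg

/-! ### Gagliardo–Nirenberg on the unit shell and rescaling -/

theorem enorm_sub_rpow_le {q : ℝ} (hq : 1 ≤ q) (x y : ℝ) :
    ‖x - y‖ₑ ^ q ≤ 2 ^ (q - 1) * (‖x‖ₑ ^ q + ‖y‖ₑ ^ q) :=
  (ENNReal.rpow_le_rpow (enorm_sub_le (a := x) (b := y)) (by linarith)).trans
    (ENNReal.rpow_add_le_mul_rpow_add_rpow _ _ hq)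

theorem enorm_setAverage_rpow_le {α : Type*} [MeasurableSpace α] {μ : Measure α} {T : Set α}
    {q : ℝ} {h : α → ℝ} (hq : 1 ≤ q) (hT0 : μ T ≠ 0) (hT : μ T ≠ ⊤) (hh : Integrable h μ) :
    ‖⨍ x in T, h x ∂μ‖ₑ ^ q ≤ (μ T)⁻¹ * ∫⁻ y in T, ‖h y‖ₑ ^ q ∂μ := by
  simpa using enorm_sub_setAverage_rpow_le hq 0 hT0 hT hh

theorem lintegral_enorm_sub_setAverage_rpow_le {α : Type*} [MeasurableSpace α] {μ : Measure α}
    {T : Set α} {q : ℝ} {h : α → ℝ} (hq : 1 ≤ q) (hT0 : μ T ≠ 0) (hT : μ T ≠ ⊤)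
    (hh : Integrable h μ) :
    ∫⁻ x in T, ‖h x - ⨍ y in T, h y ∂μ‖ₑ ^ q ∂μ ≤
      2 ^ (q - 1) * 2 * ∫⁻ x in T, ‖h x‖ₑ ^ q ∂μ := by
  have htwo : (2 : ENNReal) ^ (q - 1) ≠ ⊤ :=
    ENNReal.rpow_ne_top_of_nonneg (by linarith) (by norm_num)
  calc ∫⁻ x in T, ‖h x - ⨍ y in T, h y ∂μ‖ₑ ^ q ∂μ
      ≤ ∫⁻ x in T, 2 ^ (q - 1) * (‖h x‖ₑ ^ q + ‖⨍ y in T, h y ∂μ‖ₑ ^ q) ∂μ :=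
        lintegral_mono fun x => enorm_sub_rpow_le hq _ _
    _ = 2 ^ (q - 1) * (∫⁻ x in T, ‖h x‖ₑ ^ q ∂μ + ‖⨍ y in T, h y ∂μ‖ₑ ^ q * μ T) := by
        rw [lintegral_const_mul' _ _ htwo, lintegral_add_right _ measurable_const,
          setLIntegral_const]
    _ ≤ 2 ^ (q - 1) * (∫⁻ x in T, ‖h x‖ₑ ^ q ∂μ + ∫⁻ x in T, ‖h x‖ₑ ^ q ∂μ) := by
        gcongr
        calc _ ≤ (μ T)⁻¹ * (∫⁻ y in T, ‖h y‖ₑ ^ q ∂μ) * μ T := by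
              gcongr; exact enorm_setAverage_rpow_le hq hT0 hT hh
          _ = _ := by rw [mul_right_comm, ENNReal.inv_mul_cancel hT0 hT, one_mul]
    _ = _ := by ring

namespace Heisenberg
variable {n : ℕ} {p q u v S κ b : ℝ}

theorem zWeight_rpow {b : ℝ} (hv : v < 1) (ξ : Heisenberg n) :
    zWeight (b / (1 - v)) ξ ^ (1 - v) = zWeight b ξ := by
  have : 1 - v ≠ 0 := by linarith
  rw [zWeight, zWeight, ← ENNReal.rpow_mul]
  congr 1
  field_simp

/-- Gagliardo–Nirenberg inequality on a shell, from the weighted embedding and Hölder's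
inequality with exponents `1 - v` and `v`. -/
theorem exists_lintegral_zWeight_mul_enorm_sub_rpow_le_mul (hn : 1 ≤ n) (hp : 1 < p) (hq : 1 ≤ q)
    (hS : 0 ≤ S) (hκ : 0 ≤ κ) (hSκ : homDim n ≤ S + κ) (hv0 : 0 ≤ v) (hv1 : v < 1)
    (huv : 1 - v ≤ u) (hb0 : 0 ≤ b) (hb : b / (1 - v) < 2 * n) :
    ∃ C : ENNReal, C ≠ ⊤ ∧ ∀ f : Heisenberg n → ℝ, Continuous f → Integrable f →
      ∫⁻ ξ in shell 1 2, zWeight b ξ * ‖f ξ - ⨍ x in shell 1 2, f x‖ₑ ^ (u * p + v * q) ≤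
        C * (shellEnergy p S κ f ^ u * (∫⁻ ξ in shell (1 / 4) 8, ‖f ξ‖ₑ ^ q) ^ v) := by
  have hv : 0 < 1 - v := by linarith
  have hp0 : 0 < p := by linarith
  set σ := u * p / (1 - v) with hσdef
  have hσ : p ≤ σ := by
    rw [hσdef, le_div_iff₀ hv, mul_comm]
    gcongr
  obtain ⟨C, hC, h⟩ := exists_lintegral_zWeight_mul_enorm_sub_rpow_le hn hp hS hκ hSκ
    (div_nonneg hb0 hv.le) hb hσ
  have hu0 : 0 ≤ u := hv.le.trans huv
  refine ⟨C ^ (1 - v) * (2 ^ (q - 1) * 2) ^ v, ?_, fun f hc hf => ?_⟩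
  · have h1 := ENNReal.rpow_ne_top_of_nonneg hv.le hC
    have h2 : (2 : ENNReal) ^ (q - 1) ≠ ⊤ :=
      ENNReal.rpow_ne_top_of_nonneg (by linarith) (by norm_num)
    have h3 : ((2 : ENNReal) ^ (q - 1) * 2) ^ v ≠ ⊤ :=
      ENNReal.rpow_ne_top_of_nonneg hv0 (by finiteness)
    finiteness
  set c := ⨍ x in shell 1 2, f x with hcdef
  have hm : Measurable fun ξ => ‖f ξ - c‖ₑ := by
    have := hc.measurable
    fun_prop
  have hw := measurable_zWeight (n := n) (b / (1 - v))
  -- `σ (1 - v) = u p`, and the weight exponent is enlarged to `b / (1 - v)` to compensate `1 - v`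
  have hpt : ∀ ξ, zWeight b ξ * ‖f ξ - c‖ₑ ^ (u * p + v * q) =
      (zWeight (b / (1 - v)) ξ * ‖f ξ - c‖ₑ ^ σ) ^ (1 - v) * (‖f ξ - c‖ₑ ^ q) ^ v := by
    intro ξ
    have hσv : σ * (1 - v) = u * p := by rw [hσdef]; field_simp
    rw [ENNReal.mul_rpow_of_nonneg _ _ hv.le, zWeight_rpow hv1, ← ENNReal.rpow_mul,
      ← ENNReal.rpow_mul, hσv, mul_assoc, ENNReal.rpow_add_of_nonneg (u * p) (v * q) (by positivity)
      (by positivity), mul_comm v q]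
  have hσu : σ / p * (1 - v) = u := by rw [hσdef]; field_simp
  calc ∫⁻ ξ in shell 1 2, zWeight b ξ * ‖f ξ - c‖ₑ ^ (u * p + v * q)
      ≤ (∫⁻ ξ in shell 1 2, zWeight (b / (1 - v)) ξ * ‖f ξ - c‖ₑ ^ σ) ^ (1 - v) *
          (∫⁻ ξ in shell 1 2, ‖f ξ - c‖ₑ ^ q) ^ v := by
        simp only [hpt]
        exact ENNReal.lintegral_mul_norm_pow_le (hw.mul (hm.pow_const _)).aemeasurable
          (hm.pow_const _).aemeasurable hv.le hv0 (by ring)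
    _ ≤ (C * shellEnergy p S κ f ^ (σ / p)) ^ (1 - v) *
          (2 ^ (q - 1) * 2 * ∫⁻ ξ in shell (1 / 4) 8, ‖f ξ‖ₑ ^ q) ^ v := by
        gcongr
        · exact h f hc hf
        · refine (lintegral_enorm_sub_setAverage_rpow_le (T := shell 1 2) hq
            (volume_shell_ne_zero (by norm_num) (by norm_num)) (volume_shell_ne_top 1 2) hf).trans ?_
          have hD : (shell 1 2 : Set (Heisenberg n)) ⊆ shell (1 / 4) 8 :=
            shell_subset_shell (by norm_num) (by norm_num)
          exact mul_le_mul' le_rfl (lintegral_mono_set hD)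
    _ = _ := by
        rw [ENNReal.mul_rpow_of_nonneg _ _ hv.le, ENNReal.mul_rpow_of_nonneg _ _ hv0,
          ← ENNReal.rpow_mul, hσu]
        ring

theorem exists_enorm_setAverage_sub_rpow_le_mul (hn : 1 ≤ n) (hp : 1 < p) (hq : 1 ≤ q)
    (hS : 0 ≤ S) (hκ : 0 ≤ κ) (hu0 : 0 ≤ u) (hv0 : 0 ≤ v) :
    ∃ C : ENNReal, C ≠ ⊤ ∧ ∀ f : Heisenberg n → ℝ, Integrable f →
      ‖(⨍ x in shell 1 2, f x) - ⨍ x in shell 2 4, f x‖ₑ ^ (u * p + v * q) ≤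
        C * (shellEnergy p S κ f ^ u * (∫⁻ ξ in shell (1 / 4) 8, ‖f ξ‖ₑ ^ q) ^ v) := by
  set V := volume (shell 1 2 : Set (Heisenberg n)) with hV
  set V' := volume (shell 2 4 : Set (Heisenberg n)) with hV'
  have hV0 : V ≠ 0 := volume_shell_ne_zero (by norm_num) (by norm_num)
  have hV0' : V' ≠ 0 := volume_shell_ne_zero (by norm_num) (by norm_num)
  have hVt : V ≠ ⊤ := volume_shell_ne_top 1 2
  have hVt' : V' ≠ ⊤ := volume_shell_ne_top 2 4
  have hD : (shell 1 2 : Set (Heisenberg n)) ⊆ shell (1 / 4) 8 :=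
    shell_subset_shell (by norm_num) (by norm_num)
  have hD' : (shell 2 4 : Set (Heisenberg n)) ⊆ shell (1 / 4) 8 :=
    shell_subset_shell (by norm_num) (by norm_num)
  set C₁ := V⁻¹ * V'⁻¹ * ENNReal.ofReal (24 ^ (homDim n + S + κ)) with hC₁
  set C₂ : ENNReal := 2 ^ (q - 1) * (V⁻¹ + V'⁻¹) with hC₂
  refine ⟨C₁ ^ u * C₂ ^ v, ?_, fun f hf => ?_⟩
  · have h2 : (2 : ENNReal) ^ (q - 1) ≠ ⊤ :=
      ENNReal.rpow_ne_top_of_nonneg (by linarith) (by norm_num)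
    have h3 : C₁ ^ u ≠ ⊤ := ENNReal.rpow_ne_top_of_nonneg hu0 (by rw [hC₁]; finiteness)
    have h4 : C₂ ^ v ≠ ⊤ := ENNReal.rpow_ne_top_of_nonneg hv0 (by rw [hC₂]; finiteness)
    finiteness
  set c := ⨍ x in shell 1 2, f x with hc
  set c' := ⨍ x in shell 2 4, f x with hc'
  have h1 : ‖c - c'‖ₑ ^ p ≤ C₁ * shellEnergy p S κ f :=
    enorm_setAverage_sub_le_shellEnergy hn hp.le hS hκ hf (measurableSet_shell _ _)
      (measurableSet_shell _ _) hD hD' hV0 hV0'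
  have h2 : ‖c - c'‖ₑ ^ q ≤ C₂ * ∫⁻ ξ in shell (1 / 4) 8, ‖f ξ‖ₑ ^ q := by
    refine (enorm_sub_rpow_le hq c c').trans ?_
    rw [hC₂, mul_assoc, add_mul]
    gcongr
    · exact (enorm_setAverage_rpow_le hq hV0 hVt hf).trans (by gcongr)
    · exact (enorm_setAverage_rpow_le hq hV0' hVt' hf).trans (by gcongr)
  calc ‖c - c'‖ₑ ^ (u * p + v * q) = (‖c - c'‖ₑ ^ p) ^ u * (‖c - c'‖ₑ ^ q) ^ v := by
        rw [← ENNReal.rpow_mul, ← ENNReal.rpow_mul, mul_comm p, mul_comm q,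
          ENNReal.rpow_add_of_nonneg (u * p) (v * q) (by positivity) (by positivity)]
    _ ≤ (C₁ * shellEnergy p S κ f) ^ u *
          (C₂ * ∫⁻ ξ in shell (1 / 4) 8, ‖f ξ‖ₑ ^ q) ^ v := by gcongr
    _ = _ := by
        rw [ENNReal.mul_rpow_of_nonneg _ _ hu0, ENNReal.mul_rpow_of_nonneg _ _ hv0]
        ring

theorem dil_preimage_shell {ρ : ℝ} (hρ : 0 < ρ) (a b : ℝ) :
    dil ρ ⁻¹' (shell (ρ * a) (ρ * b) : Set (Heisenberg n)) = shell a b := by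
  ext ξ
  simp only [shell, Set.mem_preimage, Set.mem_ofPred_eq, gauge_dil hρ.le]
  rw [mul_le_mul_iff_right₀ hρ, mul_lt_mul_iff_right₀ hρ]

theorem setLIntegral_comp_dil {ρ : ℝ} (hρ : 0 < ρ) (a b : ℝ) {F : Heisenberg n → ENNReal}
    (hF : Measurable F) :
    ∫⁻ ξ in shell a b, F (dil ρ ξ) =
      ENNReal.ofReal (ρ ^ (-homDim n)) * ∫⁻ ξ in shell (ρ * a) (ρ * b), F ξ := by
  rw [← lintegral_indicator (measurableSet_shell _ _), ← lintegral_indicator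
    (measurableSet_shell _ _), ← lintegral_comp_dil hρ (hF.indicator (measurableSet_shell _ _))]
  congr 1
  ext ξ
  rw [← dil_preimage_shell hρ a b]
  rfl

theorem setAverage_comp_dil {ρ : ℝ} (hρ : 0 < ρ) (a b : ℝ) {g : Heisenberg n → ℝ}
    (hg : Continuous g) :
    ⨍ ξ in shell a b, g (dil ρ ξ) = ⨍ ξ in shell (ρ * a) (ρ * b), g ξ := by
  have hc : (0 : ℝ) < ρ ^ (-homDim n) := by positivity
  have hdm := (continuous_dil (n := n) ρ).measurable
  have hI : ∫ ξ in shell a b, g (dil ρ ξ) =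
      ρ ^ (-homDim n) * ∫ ξ in shell (ρ * a) (ρ * b), g ξ := by
    have := setIntegral_map (μ := volume) (g := dil ρ) (f := g)
      (measurableSet_shell (n := n) (ρ * a) (ρ * b)) hg.aestronglyMeasurable hdm.aemeasurable
    rw [dil_preimage_shell hρ, map_dil hρ, Measure.restrict_smul, integral_smul_measure,
      ENNReal.toReal_ofReal hc.le, smul_eq_mul] at this
    exact this.symm
  have hV : volume.real (shell a b : Set (Heisenberg n)) =
      ρ ^ (-homDim n) * volume.real (shell (ρ * a) (ρ * b) : Set (Heisenberg n)) := by
    rw [Measure.real, Measure.real, ← dil_preimage_shell hρ a b,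
      ← Measure.map_apply hdm (measurableSet_shell _ _), map_dil hρ, Measure.smul_apply,
      smul_eq_mul, ENNReal.toReal_mul, ENNReal.toReal_ofReal hc.le]
  rw [setAverage_eq, setAverage_eq, hI, hV, smul_eq_mul, smul_eq_mul, mul_inv]
  field_simp

theorem kernel_comp_dil {ρ : ℝ} (hρ : 0 < ρ) (f : Heisenberg n → ℝ) (ξ η : Heisenberg n) :
    kernel p S κ (fun x => f (dil ρ x)) ξ η =
      ENNReal.ofReal (ρ ^ (homDim n + S + κ)) * kernel p S κ f (dil ρ ξ) (dil ρ η) := by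
  rw [kernel, kernel, op_inverse_dil, dil_sub_dil, gauge_dil hρ.le, zNorm_dil hρ.le,
    Real.mul_rpow hρ.le (gauge_nonneg _), Real.mul_rpow hρ.le (zNorm_nonneg _),
    ← ENNReal.ofReal_mul (by positivity), Real.rpow_add hρ]
  congr 1
  have h1 : ρ ^ (homDim n + S) ≠ 0 := by positivity
  have h2 : ρ ^ κ ≠ 0 := by positivity
  rw [mul_mul_mul_comm, ← mul_div_mul_left _ (_ * _) (mul_ne_zero h1 h2), mul_div_assoc]

theorem shellEnergy_comp_dil {ρ : ℝ} (hρ : 0 < ρ) {f : Heisenberg n → ℝ} (hf : Measurable f) :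
    shellEnergy p S κ (fun x => f (dil ρ x)) = ENNReal.ofReal (ρ ^ (S + κ - homDim n)) *
      ∫⁻ ξ in shell (ρ * (1 / 4)) (ρ * 8), ∫⁻ η in shell (ρ * (1 / 4)) (ρ * 8),
        kernel p S κ f ξ η := by
  have hK := measurable_kernel (n := n) p S κ hf
  have hin : ∀ ξ : Heisenberg n, ∫⁻ η in shell (1 / 4) 8, kernel p S κ (fun x => f (dil ρ x)) ξ η =
      ENNReal.ofReal (ρ ^ (homDim n + S + κ)) * (ENNReal.ofReal (ρ ^ (-homDim n)) *
        ∫⁻ η in shell (ρ * (1 / 4)) (ρ * 8), kernel p S κ f (dil ρ ξ) η) := by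
    intro ξ
    simp only [kernel_comp_dil hρ]
    rw [lintegral_const_mul' _ _ ENNReal.ofReal_ne_top,
      setLIntegral_comp_dil hρ _ _ (F := kernel p S κ f (dil ρ ξ)) hK.of_uncurry_left]
  rw [shellEnergy]
  simp only [hin]
  rw [lintegral_const_mul' _ _ ENNReal.ofReal_ne_top, lintegral_const_mul' _ _ ENNReal.ofReal_ne_top,
    setLIntegral_comp_dil hρ _ _ (F := fun ξ => ∫⁻ η in shell (ρ * (1 / 4)) (ρ * 8),
      kernel p S κ f ξ η) hK.lintegral_prod_right', ← mul_assoc, ← mul_assoc,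
    ← ENNReal.ofReal_mul (by positivity), ← ENNReal.ofReal_mul (by positivity),
    ← Real.rpow_add hρ, ← Real.rpow_add hρ]
  congr 3
  ring

end Heisenberg

/-! ### Local inequalities at all scales -/

/-- A family of sets covering each point at most five times, within a window of indices. -/
theorem tsum_setLIntegral_le_of_overlap {α : Type*} [MeasurableSpace α] {μ : Measure α}
    {D : ℕ → Set α} (hD : ∀ j, MeasurableSet (D j))
    (hov : ∀ x, ∃ j₀, ∀ j, x ∈ D j → j₀ ≤ j ∧ j < j₀ + 5) {g : α → ENNReal} (hg : Measurable g) :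
    ∑' j, ∫⁻ x in D j, g x ∂μ ≤ 5 * ∫⁻ x, g x ∂μ := by
  rw [← lintegral_const_mul _ hg]
  simp only [← lintegral_indicator (hD _)]
  rw [← lintegral_tsum fun j => (hg.indicator (hD j)).aemeasurable]
  refine lintegral_mono fun x => ?_
  obtain ⟨j₀, hj₀⟩ := hov x
  rw [tsum_eq_sum (s := Finset.Ico j₀ (j₀ + 5)) fun j hj =>
    Set.indicator_of_notMem (fun h => hj (Finset.mem_Ico.2 (hj₀ j h))) _]
  calc ∑ j ∈ Finset.Ico j₀ (j₀ + 5), (D j).indicator g x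
      ≤ ∑ _j ∈ Finset.Ico j₀ (j₀ + 5), g x :=
        Finset.sum_le_sum fun j _ => Set.indicator_le_self' (fun _ _ => zero_le) x
    _ = 5 * g x := by simp

namespace Heisenberg
variable {n : ℕ} {p q u v S κ b e : ℝ}

/-- The weight `d(ξ)^(-e) |z|^(-b)`. It is homogeneous of degree `-Q` under the dilations when
`e + b = Q`. -/
def hardyWeight (e b : ℝ) (ξ : Heisenberg n) : ENNReal :=
  ENNReal.ofReal (gauge ξ ^ (-e) * zNorm ξ ^ (-b))

theorem measurable_hardyWeight (e b : ℝ) :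
    Measurable (hardyWeight e b : Heisenberg n → ENNReal) := by
  have h1 := (continuous_gauge (n := n)).measurable
  have h2 := (continuous_zNorm (n := n)).measurable
  unfold hardyWeight; fun_prop

theorem hardyWeight_dil (heb : e + b = homDim n) {ρ : ℝ} (hρ : 0 < ρ) (ξ : Heisenberg n) :
    hardyWeight e b (dil ρ ξ) = ENNReal.ofReal (ρ ^ (-homDim n)) * hardyWeight e b ξ := by
  rw [hardyWeight, hardyWeight, gauge_dil hρ.le, zNorm_dil hρ.le,
    Real.mul_rpow hρ.le (gauge_nonneg _), Real.mul_rpow hρ.le (zNorm_nonneg _),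
    ← ENNReal.ofReal_mul (by positivity), mul_mul_mul_comm, ← Real.rpow_add hρ, ← heb, neg_add]

theorem hardyWeight_le_zWeight (he : 0 ≤ e) (hb : 0 ≤ b) {ξ : Heisenberg n} (hξ : 1 ≤ gauge ξ) :
    hardyWeight e b ξ ≤ zWeight b ξ := by
  have h1 : gauge ξ ^ (-e) ≤ 1 := Real.rpow_le_one_of_one_le_of_nonpos hξ (by linarith)
  have h0 := zNorm_nonneg ξ
  calc hardyWeight e b ξ ≤ ENNReal.ofReal (zNorm ξ ^ (-b)) := by
        apply ENNReal.ofReal_le_ofReal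
        exact mul_le_of_le_one_left (by positivity) h1
    _ ≤ zWeight b ξ := by
        rcases h0.eq_or_lt with hz | hz
        · rcases hb.eq_or_lt with rfl | hb
          · simp [zWeight]
          · rw [← hz, Real.zero_rpow (by linarith), ENNReal.ofReal_zero]; exact zero_le
        · rw [zWeight, ENNReal.ofReal_rpow_of_pos hz]

theorem integrable_comp_dil {f : Heisenberg n → ℝ} (hf : Integrable f) {ρ : ℝ} (hρ : 0 < ρ) :
    Integrable fun ξ => f (dil ρ ξ) := by
  have h : Integrable f (Measure.map (dil ρ) volume) := by
    rw [map_dil hρ]; exact hf.smul_measure ENNReal.ofReal_ne_top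
  exact h.comp_measurable (continuous_dil ρ).measurable

/-- The mean value of `f` over the shell `{ρ ≤ d < 2ρ}`, computed after rescaling to `ρ = 1`. -/
def shellMean (f : Heisenberg n → ℝ) (ρ : ℝ) : ℝ := ⨍ ξ in shell 1 2, f (dil ρ ξ)

/-- The product of powers of the energy and of the `L^q` mass of `f` at the scale `ρ`. -/
def scaleBound (p q u v S κ : ℝ) (f : Heisenberg n → ℝ) (ρ : ℝ) : ENNReal :=
  (∫⁻ ξ in shell (ρ * (1 / 4)) (ρ * 8), ∫⁻ η in shell (ρ * (1 / 4)) (ρ * 8),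
    kernel p S κ f ξ η) ^ u * (∫⁻ ξ in shell (ρ * (1 / 4)) (ρ * 8), ‖f ξ‖ₑ ^ q) ^ v

/-- The quantity bounding the local inequalities is invariant under dilations precisely when
`(S + κ - Q) u = Q v`. -/
theorem shellEnergy_rpow_mul_comp_dil (hu0 : 0 ≤ u) (hv0 : 0 ≤ v)
    (hscale : (S + κ - homDim n) * u = homDim n * v) {ρ : ℝ} (hρ : 0 < ρ) {f : Heisenberg n → ℝ}
    (hf : Measurable f) :
    shellEnergy p S κ (fun x => f (dil ρ x)) ^ u *
      (∫⁻ ξ in shell (1 / 4) 8, ‖f (dil ρ ξ)‖ₑ ^ q) ^ v = scaleBound p q u v S κ f ρ := by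
  rw [shellEnergy_comp_dil hρ hf, setLIntegral_comp_dil hρ _ _ (F := fun ξ => ‖f ξ‖ₑ ^ q)
    (hf.enorm.pow_const q), ENNReal.mul_rpow_of_nonneg _ _ hu0, ENNReal.mul_rpow_of_nonneg _ _ hv0,
    mul_mul_mul_comm, ENNReal.ofReal_rpow_of_pos (by positivity),
    ENNReal.ofReal_rpow_of_pos (by positivity), ← ENNReal.ofReal_mul (by positivity),
    ← Real.rpow_mul hρ.le, ← Real.rpow_mul hρ.le, ← Real.rpow_add hρ, hscale]
  have : homDim n * v + -homDim n * v = 0 := by ring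
  rw [this, Real.rpow_zero, ENNReal.ofReal_one, one_mul, scaleBound]

theorem lintegral_zWeight_ne_top_and_hardyWeight_le (hn : 1 ≤ n) (he : 0 ≤ e)
    (hb0 : 0 ≤ b) (hb : b < 2 * n) :
    ∫⁻ ξ in shell (n := n) 1 2, zWeight b ξ ≠ ⊤ ∧
      ∫⁻ ξ in shell (n := n) 1 2, hardyWeight e b ξ ≤ ∫⁻ ξ in shell (n := n) 1 2, zWeight b ξ := by
  obtain ⟨C, hC, h⟩ := exists_lintegral_gaugeBall_zWeight_le hn hb0 hb 2
  constructor
  · exact ne_top_of_le_ne_top (by finiteness : C * ENNReal.ofReal (2 ^ 2) ≠ ⊤)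
      ((lintegral_mono_set (shell_subset_gaugeBall 1 2)).trans (h 0 2 two_pos le_rfl))
  · exact setLIntegral_mono' (measurableSet_shell _ _) fun ξ hξ => hardyWeight_le_zWeight he hb0 hξ.1

/-- The two local inequalities at an arbitrary scale. -/
theorem exists_scale_inequalities (hn : 1 ≤ n) (hp : 1 < p) (hq : 1 ≤ q)
    (hS : 0 ≤ S) (hκ : 0 ≤ κ) (hSκ : homDim n ≤ S + κ) (hv0 : 0 ≤ v) (hv1 : v < 1)
    (huv : 1 - v ≤ u) (he : 0 ≤ e) (hb0 : 0 ≤ b) (hb : b / (1 - v) < 2 * n)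
    (heb : e + b = homDim n) (hscale : (S + κ - homDim n) * u = homDim n * v)
    (hτ : 1 ≤ u * p + v * q) :
    ∃ C : ENNReal, C ≠ ⊤ ∧ ∀ f : Heisenberg n → ℝ, Continuous f → Integrable f → ∀ ρ : ℝ, 0 < ρ →
      ∫⁻ ξ in shell (ρ * 1) (ρ * 2), hardyWeight e b ξ * ‖f ξ‖ₑ ^ (u * p + v * q) ≤
        C * (scaleBound p q u v S κ f ρ + ‖shellMean f ρ‖ₑ ^ (u * p + v * q)) ∧
      ‖shellMean f ρ - shellMean f (ρ * 2)‖ₑ ^ (u * p + v * q) ≤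
        C * scaleBound p q u v S κ f ρ := by
  have hu0 : 0 ≤ u := by linarith
  have hb2 : b < 2 * n := lt_of_le_of_lt
    ((le_div_iff₀ (by linarith)).2 (mul_le_of_le_one_right hb0 (by linarith))) hb
  obtain ⟨C₁, hC₁, h₁⟩ := exists_lintegral_zWeight_mul_enorm_sub_rpow_le_mul
    hn hp hq hS hκ hSκ hv0 hv1 huv hb0 hb
  obtain ⟨C₂, hC₂, h₂⟩ := exists_enorm_setAverage_sub_rpow_le_mul
    hn hp hq hS hκ hu0 hv0
  obtain ⟨hWt, hW⟩ := lintegral_zWeight_ne_top_and_hardyWeight_le hn he hb0 hb2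
  set W := ∫⁻ ξ in shell (n := n) 1 2, zWeight b ξ with hWdef
  set τ := u * p + v * q with hτdef
  have htwo : (2 : ENNReal) ^ (τ - 1) ≠ ⊤ :=
    ENNReal.rpow_ne_top_of_nonneg (by linarith) (by norm_num)
  refine ⟨2 ^ (τ - 1) * (C₁ + W) + C₂, by finiteness, fun f hc hf ρ hρ => ⟨?_, ?_⟩⟩
  · set g : Heisenberg n → ℝ := fun ξ => f (dil ρ ξ) with hg
    have hgc : Continuous g := by simp only [hg]; fun_prop
    have hgi : Integrable g := integrable_comp_dil hf hρ
    have hw := measurable_hardyWeight (n := n) e b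
    have hgm := hgc.measurable
    have hfm := hc.measurable
    have hresc : ∫⁻ ξ in shell (ρ * 1) (ρ * 2), hardyWeight e b ξ * ‖f ξ‖ₑ ^ τ =
        ∫⁻ ξ in shell 1 2, hardyWeight e b ξ * ‖g ξ‖ₑ ^ τ := by
      have h := setLIntegral_comp_dil hρ 1 2 (F := fun ξ => hardyWeight e b ξ * ‖f ξ‖ₑ ^ τ)
        (hw.mul (hfm.enorm.pow_const τ))
      simp only [hardyWeight_dil heb hρ, mul_assoc] at h
      rw [lintegral_const_mul' _ _ ENNReal.ofReal_ne_top] at h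
      exact ((ENNReal.mul_right_inj (ENNReal.ofReal_pos.2 (by positivity)).ne'
        ENNReal.ofReal_ne_top).1 h).symm
    set c := shellMean f ρ with hcdef
    have hpt : ∀ ξ, ‖g ξ‖ₑ ^ τ ≤ 2 ^ (τ - 1) * (‖g ξ - c‖ₑ ^ τ + ‖c‖ₑ ^ τ) := fun ξ => by
      have h : ‖g ξ‖ₑ ≤ ‖g ξ - c‖ₑ + ‖c‖ₑ := by
        simpa using enorm_add_le (g ξ - c) c
      exact (ENNReal.rpow_le_rpow h (by linarith)).trans
        (ENNReal.rpow_add_le_mul_rpow_add_rpow _ _ hτ)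
    rw [hresc]
    calc ∫⁻ ξ in shell 1 2, hardyWeight e b ξ * ‖g ξ‖ₑ ^ τ
        ≤ ∫⁻ ξ in shell 1 2, 2 ^ (τ - 1) * (zWeight b ξ * ‖g ξ - c‖ₑ ^ τ +
            hardyWeight e b ξ * ‖c‖ₑ ^ τ) := by
          refine setLIntegral_mono' (measurableSet_shell _ _) fun ξ hξ => ?_
          calc hardyWeight e b ξ * ‖g ξ‖ₑ ^ τ
              ≤ hardyWeight e b ξ * (2 ^ (τ - 1) * (‖g ξ - c‖ₑ ^ τ + ‖c‖ₑ ^ τ)) := by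
                gcongr; exact hpt ξ
            _ = 2 ^ (τ - 1) * (hardyWeight e b ξ * ‖g ξ - c‖ₑ ^ τ +
                  hardyWeight e b ξ * ‖c‖ₑ ^ τ) := by ring
            _ ≤ _ := by gcongr; exact hardyWeight_le_zWeight he hb0 hξ.1
      _ = 2 ^ (τ - 1) * ((∫⁻ ξ in shell 1 2, zWeight b ξ * ‖g ξ - c‖ₑ ^ τ) +
            (∫⁻ ξ in shell 1 2, hardyWeight e b ξ) * ‖c‖ₑ ^ τ) := by
          rw [lintegral_const_mul' _ _ htwo, lintegral_add_right _ (hw.mul_const _),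
            lintegral_mul_const _ hw]
      _ ≤ 2 ^ (τ - 1) * (C₁ * scaleBound p q u v S κ f ρ + W * ‖c‖ₑ ^ τ) := by
          gcongr
          rw [← shellEnergy_rpow_mul_comp_dil hu0 hv0 hscale hρ hfm]
          exact h₁ g hgc hgi
      _ ≤ 2 ^ (τ - 1) * ((C₁ + W) * scaleBound p q u v S κ f ρ + (C₁ + W) * ‖c‖ₑ ^ τ) := by
          gcongr
          · exact le_self_add
          · exact le_add_self
      _ = 2 ^ (τ - 1) * (C₁ + W) * (scaleBound p q u v S κ f ρ + ‖c‖ₑ ^ τ) := by ring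
      _ ≤ _ := by gcongr; exact le_self_add
  · have hmean : shellMean f (ρ * 2) = ⨍ ξ in shell 2 4, f (dil ρ ξ) := by
      have h := setAverage_comp_dil (n := n) (ρ := 2) two_pos 1 2
        (g := fun ξ => f (dil ρ ξ)) (by fun_prop)
      simp only [dil_dil] at h
      norm_num at h
      rw [shellMean, h]
    rw [hmean, ← shellEnergy_rpow_mul_comp_dil hu0 hv0 hscale hρ hc.measurable]
    refine (h₂ _ (integrable_comp_dil hf hρ)).trans ?_
    gcongr
    exact le_add_self

theorem overlap_shell {β ρ₀ : ℝ} (hβ : β = 2 ∨ β = 1 / 2) (hρ₀ : 0 < ρ₀) (ξ : Heisenberg n) :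
    ∃ j₀ : ℕ, ∀ j : ℕ, ξ ∈ shell (n := n) (ρ₀ * β ^ j * (1 / 4)) (ρ₀ * β ^ j * 8) →
      j₀ ≤ j ∧ j < j₀ + 5 := by
  classical
  by_cases hex : ∃ j : ℕ, ξ ∈ shell (n := n) (ρ₀ * β ^ j * (1 / 4)) (ρ₀ * β ^ j * 8)
  · refine ⟨Nat.find hex, fun j hj => ⟨Nat.find_min' hex hj, ?_⟩⟩
    obtain ⟨h1, h2⟩ := Nat.find_spec hex
    obtain ⟨h3, h4⟩ := hj
    set j₀ := Nat.find hex
    by_contra! hlt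
    obtain ⟨k, rfl⟩ := Nat.exists_eq_add_of_le hlt
    have hpow : β ^ (j₀ + 5 + k) = β ^ j₀ * β ^ 5 * β ^ k := by rw [pow_add, pow_add]
    rw [hpow] at h3 h4
    have hβ0 : 0 < β := by rcases hβ with rfl | rfl <;> norm_num
    have hX : 0 < ρ₀ * β ^ j₀ := by positivity
    rcases hβ with rfl | rfl
    · have hk : (1 : ℝ) ≤ 2 ^ k := one_le_pow₀ (by norm_num)
      nlinarith
    · have hk : (1 / 2 : ℝ) ^ k ≤ 1 := pow_le_one₀ (by norm_num) (by norm_num)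
      nlinarith
  · push Not at hex
    exact ⟨0, fun j hj => absurd hj (hex j)⟩

theorem tsum_scaleBound_le (hv0 : 0 ≤ v) (hv1 : v < 1) (huv : 1 - v ≤ u) {β ρ₀ : ℝ}
    (hβ : β = 2 ∨ β = 1 / 2) (hρ₀ : 0 < ρ₀) {f : Heisenberg n → ℝ} (hf : Measurable f) :
    ∑' j : ℕ, scaleBound p q u v S κ f (ρ₀ * β ^ j) ≤
      (5 * ∫⁻ ξ, ∫⁻ η, kernel p S κ f ξ η) ^ u * (5 * ∫⁻ ξ, ‖f ξ‖ₑ ^ q) ^ v := by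
  refine (ENNReal.tsum_rpow_mul_rpow_le hv0 hv1.le huv _ _).trans ?_
  have hu0 : 0 ≤ u := by linarith
  have hD : ∀ j : ℕ, MeasurableSet
      (shell (ρ₀ * β ^ j * (1 / 4)) (ρ₀ * β ^ j * 8) : Set (Heisenberg n)) :=
    fun j => measurableSet_shell _ _
  gcongr
  · refine le_trans (ENNReal.tsum_le_tsum fun j => lintegral_mono fun ξ =>
      setLIntegral_le_lintegral _ _) ?_
    exact tsum_setLIntegral_le_of_overlap hD (overlap_shell hβ hρ₀)
      (measurable_kernel p S κ hf).lintegral_prod_right'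
  · exact tsum_setLIntegral_le_of_overlap hD (overlap_shell hβ hρ₀) (hf.enorm.pow_const q)

/-- The differences of consecutive shell means are summable with the right bound, along an
increasing or a decreasing dyadic sequence of scales. -/
theorem tsum_shellMean_sub_le {τ : ℝ} {C : ENNReal} {f : Heisenberg n → ℝ} {B : ℝ → ENNReal}
    (h : ∀ ρ : ℝ, 0 < ρ → ‖shellMean f ρ - shellMean f (ρ * 2)‖ₑ ^ τ ≤ C * B ρ)
    {β ρ₀ : ℝ} (hβ : β = 2 ∨ β = 1 / 2) (hρ₀ : 0 < ρ₀) :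
    ∑' j : ℕ, ‖shellMean f (ρ₀ * β ^ (j + 1)) - shellMean f (ρ₀ * β ^ j)‖ₑ ^ τ ≤
      C * ∑' j : ℕ, B (ρ₀ * β ^ j) := by
  rw [← ENNReal.tsum_mul_left]
  rcases hβ with rfl | rfl
  · refine ENNReal.tsum_le_tsum fun j => ?_
    have := h (ρ₀ * 2 ^ j) (by positivity)
    rw [enorm_sub_rev, pow_succ, ← mul_assoc]
    exact this
  · refine le_trans (ENNReal.tsum_le_tsum fun j => ?_) (ENNReal.tsum_comp_le_tsum_of_injective
      (add_left_injective 1) fun j => C * B (ρ₀ * (1 / 2) ^ j))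
    have := h (ρ₀ * (1 / 2) ^ (j + 1)) (by positivity)
    have h2 : ρ₀ * (1 / 2) ^ (j + 1) * 2 = ρ₀ * (1 / 2) ^ j := by ring
    rw [h2] at this
    exact this

end Heisenberg

/-! ### Summation over dyadic shells -/

namespace Heisenberg
variable {n : ℕ} {p q u v S κ b e : ℝ}

theorem shellMean_eq_zero {f : Heisenberg n → ℝ} {ρ : ℝ} (hρ : 0 < ρ)
    (h : ∀ ξ ∈ shell (n := n) ρ (ρ * 2), f ξ = 0) : shellMean f ρ = 0 := by
  have h0 : ∫ ξ in shell 1 2, f (dil ρ ξ) = 0 := by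
    refine setIntegral_eq_zero_of_forall_eq_zero fun ξ hξ => h _ ⟨?_, ?_⟩
    · rw [gauge_dil hρ.le]; have := hξ.1; nlinarith
    · rw [gauge_dil hρ.le]; have := hξ.2; nlinarith
  rw [shellMean, setAverage_eq, h0, smul_zero]

/-- The dyadic form of the inequality, with the weight `(j + 1)^(-τ)` on the `j`-th shell. The
means start from `0` on the shell where `f` vanishes, so that the discrete Hardy inequality
bounds them by their increments. -/
theorem exists_tsum_hardyWeight_le (hn : 1 ≤ n) (hp : 1 < p) (hq : 1 ≤ q)
    (hS : 0 ≤ S) (hκ : 0 ≤ κ) (hSκ : homDim n ≤ S + κ) (hv0 : 0 ≤ v) (hv1 : v < 1)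
    (huv : 1 - v ≤ u) (he : 0 ≤ e) (hb0 : 0 ≤ b) (hb : b / (1 - v) < 2 * n)
    (heb : e + b = homDim n) (hscale : (S + κ - homDim n) * u = homDim n * v)
    (hτ : 1 < u * p + v * q) :
    ∃ C : ENNReal, C ≠ ⊤ ∧ ∀ f : Heisenberg n → ℝ, Continuous f → Integrable f →
      ∀ β ρ₀ : ℝ, (β = 2 ∨ β = 1 / 2) → 0 < ρ₀ →
      (∀ ξ ∈ shell (n := n) ρ₀ (ρ₀ * 2), f ξ = 0) →
      ∑' j : ℕ, ENNReal.ofReal (((j : ℝ) + 1) ^ (-(u * p + v * q))) *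
        ∫⁻ ξ in shell (ρ₀ * β ^ j * 1) (ρ₀ * β ^ j * 2),
          hardyWeight e b ξ * ‖f ξ‖ₑ ^ (u * p + v * q) ≤
        C * ((∫⁻ ξ, ∫⁻ η, kernel p S κ f ξ η) ^ u * (∫⁻ ξ, ‖f ξ‖ₑ ^ q) ^ v) := by
  have hu0 : 0 ≤ u := by linarith
  obtain ⟨C, hC, h⟩ := exists_scale_inequalities hn hp hq hS hκ hSκ hv0 hv1 huv he hb0 hb heb
    hscale hτ.le
  set τ := u * p + v * q with hτdef
  set H : ENNReal := ENNReal.ofReal ((τ / (τ - 1)) ^ τ) with hH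
  have h5 : ∀ x : ℝ, 0 ≤ x → (5 : ENNReal) ^ x ≠ ⊤ := fun x hx =>
    ENNReal.rpow_ne_top_of_nonneg hx (by norm_num)
  refine ⟨C * (1 + H * C) * (5 ^ u * 5 ^ v), ?_, fun f hc hf β ρ₀ hβ hρ₀ hzero => ?_⟩
  · have := h5 u hu0
    have := h5 v hv0
    finiteness
  have hβ0 : 0 < β := by rcases hβ with rfl | rfl <;> norm_num
  set ρ : ℕ → ℝ := fun j => ρ₀ * β ^ j with hρ
  have hρpos : ∀ j, 0 < ρ j := fun j => by simp only [hρ]; positivity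
  set c : ℕ → ℝ := fun j => shellMean f (ρ j) with hcdef
  have hc0 : c 0 = 0 := by
    have := shellMean_eq_zero hρ₀ hzero
    simpa [hcdef, hρ] using this
  set T := ∑' j : ℕ, scaleBound p q u v S κ f (ρ j) with hT
  have hTle : T ≤ (5 ^ u * 5 ^ v) *
      ((∫⁻ ξ, ∫⁻ η, kernel p S κ f ξ η) ^ u * (∫⁻ ξ, ‖f ξ‖ₑ ^ q) ^ v) := by
    refine (tsum_scaleBound_le hv0 hv1 huv hβ hρ₀ hc.measurable).trans_eq ?_
    rw [ENNReal.mul_rpow_of_nonneg _ _ hu0, ENNReal.mul_rpow_of_nonneg _ _ hv0]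
    ring
  have hhardy : ∑' j : ℕ, ‖c j / (j + 1)‖ₑ ^ τ ≤ H * (C * T) :=
    (ENNReal.hardy_tsum_le hτ hc0).trans
      (mul_le_mul' le_rfl (tsum_shellMean_sub_le (fun ρ hρ => (h f hc hf ρ hρ).2) hβ hρ₀))
  have hterm : ∀ j : ℕ, ENNReal.ofReal (((j : ℝ) + 1) ^ (-τ)) *
      (∫⁻ ξ in shell (ρ j * 1) (ρ j * 2), hardyWeight e b ξ * ‖f ξ‖ₑ ^ τ) ≤
      C * (scaleBound p q u v S κ f (ρ j) + ‖c j / (j + 1)‖ₑ ^ τ) := by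
    intro j
    have hj : (0 : ℝ) < (j : ℝ) + 1 := by positivity
    have hl1 : ENNReal.ofReal (((j : ℝ) + 1) ^ (-τ)) ≤ 1 := by
      rw [← ENNReal.ofReal_one]
      exact ENNReal.ofReal_le_ofReal (Real.rpow_le_one_of_one_le_of_nonpos
        (by linarith [(Nat.cast_nonneg j : (0 : ℝ) ≤ j)]) (by linarith))
    have hl2 : ‖c j / (j + 1)‖ₑ ^ τ = ENNReal.ofReal (((j : ℝ) + 1) ^ (-τ)) * ‖c j‖ₑ ^ τ := by
      rw [div_eq_inv_mul, enorm_mul, ENNReal.mul_rpow_of_nonneg _ _ (by linarith),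
        Real.enorm_of_nonneg (by positivity), ENNReal.ofReal_rpow_of_pos (by positivity),
        Real.inv_rpow hj.le, ← Real.rpow_neg hj.le]
    calc _ ≤ ENNReal.ofReal (((j : ℝ) + 1) ^ (-τ)) *
          (C * (scaleBound p q u v S κ f (ρ j) + ‖c j‖ₑ ^ τ)) := by
            gcongr; exact (h f hc hf (ρ j) (hρpos j)).1
      _ = C * (ENNReal.ofReal (((j : ℝ) + 1) ^ (-τ)) * scaleBound p q u v S κ f (ρ j) +
            ‖c j / (j + 1)‖ₑ ^ τ) := by rw [hl2]; ring
      _ ≤ _ := by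
            gcongr
            exact mul_le_of_le_one_left zero_le hl1
  calc _ ≤ ∑' j : ℕ, C * (scaleBound p q u v S κ f (ρ j) + ‖c j / (j + 1)‖ₑ ^ τ) :=
        ENNReal.tsum_le_tsum hterm
    _ = C * (T + ∑' j : ℕ, ‖c j / (j + 1)‖ₑ ^ τ) := by
        rw [ENNReal.tsum_mul_left, ENNReal.tsum_add]
    _ ≤ C * (T + H * (C * T)) := by gcongr
    _ = C * (1 + H * C) * T := by ring
    _ ≤ C * (1 + H * C) * ((5 ^ u * 5 ^ v) *
      ((∫⁻ ξ, ∫⁻ η, kernel p S κ f ξ η) ^ u * (∫⁻ ξ, ‖f ξ‖ₑ ^ q) ^ v)) := by gcongr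
    _ = _ := by ring

/-- Passage from the dyadic sum to an integral with a weight `ℓ` that is at least
`(j + 1) log 2` on the `j`-th shell. -/
theorem lintegral_div_log_rpow_le {τ : ℝ} (hτ : 0 < τ) (he : 0 < e) {f : Heisenberg n → ℝ}
    {ℓ : Heisenberg n → ℝ} {ρ : ℕ → ℝ}
    (hcover : ∀ ξ, f ξ ≠ 0 → 0 < gauge ξ → ∃ j, ξ ∈ shell (n := n) (ρ j * 1) (ρ j * 2))
    (hℓ : ∀ j, ∀ ξ ∈ shell (n := n) (ρ j * 1) (ρ j * 2), f ξ ≠ 0 →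
      ((j : ℝ) + 1) * Real.log 2 ≤ ℓ ξ) :
    ∫⁻ ξ, ENNReal.ofReal (gauge ξ ^ (-e) * zNorm ξ ^ (-b) / ℓ ξ ^ τ * |f ξ| ^ τ) ≤
      ENNReal.ofReal (Real.log 2 ^ (-τ)) *
        ∑' j : ℕ, ENNReal.ofReal (((j : ℝ) + 1) ^ (-τ)) *
          ∫⁻ ξ in shell (ρ j * 1) (ρ j * 2), hardyWeight e b ξ * ‖f ξ‖ₑ ^ τ := by
  have hlog : 0 < Real.log 2 := Real.log_pos (by norm_num)
  set F : Heisenberg n → ENNReal := fun ξ =>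
    ENNReal.ofReal (gauge ξ ^ (-e) * zNorm ξ ^ (-b) / ℓ ξ ^ τ * |f ξ| ^ τ) with hF
  have hsupp : Function.support F ⊆ ⋃ j, shell (ρ j * 1) (ρ j * 2) := by
    intro ξ hξ
    have hf : f ξ ≠ 0 := by
      intro h0
      apply hξ
      simp [hF, h0, Real.zero_rpow hτ.ne']
    -- at the origin the real power `0 ^ (-e)` is `0`, so the integrand vanishes there
    have hd : 0 < gauge ξ := by
      refine (gauge_nonneg ξ).lt_of_ne' fun h0 => hξ ?_
      simp [hF, h0, Real.zero_rpow (neg_ne_zero.2 he.ne')]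
    exact Set.mem_iUnion.2 (hcover ξ hf hd)
  have hpt : ∀ j, ∀ ξ ∈ shell (n := n) (ρ j * 1) (ρ j * 2),
      F ξ ≤ ENNReal.ofReal (Real.log 2 ^ (-τ)) * (ENNReal.ofReal (((j : ℝ) + 1) ^ (-τ)) *
        (hardyWeight e b ξ * ‖f ξ‖ₑ ^ τ)) := by
    intro j ξ hξ
    by_cases hf : f ξ = 0
    · simp [hF, hf, Real.zero_rpow hτ.ne']
    have hj : (0 : ℝ) < (j : ℝ) + 1 := by positivity
    have hl := hℓ j ξ hξ hf
    have hd := gauge_nonneg ξ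
    have hz := zNorm_nonneg ξ
    rw [hardyWeight, ← ofReal_norm, Real.norm_eq_abs,
      ENNReal.ofReal_rpow_of_nonneg (abs_nonneg _) hτ.le,
      ← ENNReal.ofReal_mul (by positivity), ← ENNReal.ofReal_mul (by positivity),
      ← ENNReal.ofReal_mul (by positivity)]
    apply ENNReal.ofReal_le_ofReal
    have h1 : (ℓ ξ ^ τ)⁻¹ ≤ Real.log 2 ^ (-τ) * ((j : ℝ) + 1) ^ (-τ) := by
      rw [← Real.mul_rpow hlog.le hj.le, Real.rpow_neg (by positivity), mul_comm (Real.log 2)]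
      gcongr
    calc gauge ξ ^ (-e) * zNorm ξ ^ (-b) / ℓ ξ ^ τ * |f ξ| ^ τ
        = (ℓ ξ ^ τ)⁻¹ * (gauge ξ ^ (-e) * zNorm ξ ^ (-b) * |f ξ| ^ τ) := by
          rw [div_eq_mul_inv]; ring
      _ ≤ Real.log 2 ^ (-τ) * ((j : ℝ) + 1) ^ (-τ) *
            (gauge ξ ^ (-e) * zNorm ξ ^ (-b) * |f ξ| ^ τ) := by gcongr
      _ = _ := by ring
  calc ∫⁻ ξ, F ξ = ∫⁻ ξ in ⋃ j, shell (ρ j * 1) (ρ j * 2), F ξ :=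
        (setLIntegral_eq_of_support_subset hsupp).symm
    _ ≤ ∑' j, ∫⁻ ξ in shell (ρ j * 1) (ρ j * 2), F ξ := lintegral_iUnion_le _ _
    _ ≤ _ := by
        rw [← ENNReal.tsum_mul_left]
        refine ENNReal.tsum_le_tsum fun j => ?_
        rw [← lintegral_const_mul' _ _ ENNReal.ofReal_ne_top,
          ← lintegral_const_mul' _ _ ENNReal.ofReal_ne_top]
        exact setLIntegral_mono' (measurableSet_shell _ _) (hpt j)

theorem exists_mem_shell_of_lt {R : ℝ} {ξ : Heisenberg n} (h0 : 0 < gauge ξ) (hR : gauge ξ < R) :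
    ∃ j : ℕ, ξ ∈ shell (n := n) (R * (1 / 2) ^ j * 1) (R * (1 / 2) ^ j * 2) := by
  classical
  have hR0 : 0 < R := h0.trans hR
  have hex : ∃ j : ℕ, R * (1 / 2) ^ j ≤ gauge ξ := by
    obtain ⟨j, hj⟩ := exists_pow_lt_of_lt_one (div_pos h0 hR0) (by norm_num : (1 / 2 : ℝ) < 1)
    exact ⟨j, by rw [lt_div_iff₀ hR0] at hj; linarith⟩
  have hspec := Nat.find_spec hex
  rcases hj : Nat.find hex with _ | k
  · rw [hj] at hspec; simp at hspec; linarith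
  · have hmin := Nat.find_min hex (m := k) (by omega)
    rw [hj] at hspec
    refine ⟨k + 1, by rw [mul_one]; exact hspec, ?_⟩
    rw [not_le] at hmin
    calc gauge ξ < _ := hmin
      _ = _ := by ring

theorem exists_mem_shell_of_le {r : ℝ} (hr : 0 < r) {ξ : Heisenberg n} (h : r ≤ gauge ξ) :
    ∃ j : ℕ, ξ ∈ shell (n := n) (r / 2 * 2 ^ j * 1) (r / 2 * 2 ^ j * 2) := by
  obtain ⟨k, hk1, hk2⟩ := exists_nat_pow_near ((one_le_div hr).2 h) one_lt_two
  rw [le_div_iff₀ hr] at hk1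
  rw [div_lt_iff₀ hr] at hk2
  refine ⟨k + 1, ?_, ?_⟩
  · calc r / 2 * 2 ^ (k + 1) * 1 = 2 ^ k * r := by ring
      _ ≤ _ := hk1
  · calc gauge ξ < 2 ^ (k + 1) * r := hk2
      _ = _ := by ring

/-- Both logarithmic inequalities in normalized exponents: `u` and `v` are the powers of the
`p`-energy and of the `L^q` mass, so that `τ = up + vq`. -/
theorem exists_log_hardy_inequalities (hn : 1 ≤ n) (hp : 1 < p) (hq : 1 ≤ q)
    (hS : 0 ≤ S) (hκ : 0 ≤ κ) (hSκ : homDim n ≤ S + κ) (hv0 : 0 ≤ v) (hv1 : v < 1)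
    (huv : 1 - v ≤ u) (he : 0 < e) (hb0 : 0 ≤ b) (hb : b / (1 - v) < 2 * n)
    (heb : e + b = homDim n) (hscale : (S + κ - homDim n) * u = homDim n * v)
    (hτ : 1 < u * p + v * q) :
    ∃ C : ENNReal, C ≠ ⊤ ∧
      (∀ R : ℝ, 0 < R → ∀ f : Heisenberg n → ℝ, Continuous f → Integrable f →
        (∀ ξ, f ξ ≠ 0 → gauge ξ < R) →
        ∫⁻ ξ, ENNReal.ofReal (gauge ξ ^ (-e) * zNorm ξ ^ (-b) /
            Real.log (4 * R / gauge ξ) ^ (u * p + v * q) * |f ξ| ^ (u * p + v * q)) ≤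
          C * ((∫⁻ ξ, ∫⁻ η, kernel p S κ f ξ η) ^ u * (∫⁻ ξ, ‖f ξ‖ₑ ^ q) ^ v)) ∧
      (∀ r : ℝ, 0 < r → ∀ f : Heisenberg n → ℝ, Continuous f → Integrable f →
        (∀ ξ, f ξ ≠ 0 → r ≤ gauge ξ) →
        ∫⁻ ξ, ENNReal.ofReal (gauge ξ ^ (-e) * zNorm ξ ^ (-b) /
            Real.log (4 * gauge ξ / r) ^ (u * p + v * q) * |f ξ| ^ (u * p + v * q)) ≤
          C * ((∫⁻ ξ, ∫⁻ η, kernel p S κ f ξ η) ^ u * (∫⁻ ξ, ‖f ξ‖ₑ ^ q) ^ v)) := by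
  obtain ⟨C, hC, h⟩ := exists_tsum_hardyWeight_le hn hp hq hS hκ hSκ hv0 hv1 huv he.le hb0 hb heb
    hscale hτ
  have hτ0 : 0 < u * p + v * q := by linarith
  refine ⟨ENNReal.ofReal (Real.log 2 ^ (-(u * p + v * q))) * C, by finiteness, ?_, ?_⟩
  · intro R hR f hc hf hsupp
    rw [mul_assoc]
    refine (lintegral_div_log_rpow_le (ρ := fun j => R * (1 / 2) ^ j) hτ0 he
      (fun ξ hξ hd => exists_mem_shell_of_lt hd (hsupp ξ hξ)) fun j ξ hξ _ => ?_).trans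
      (mul_le_mul' le_rfl (h f hc hf (1 / 2) R (Or.inr rfl) hR fun ξ hξ => ?_))
    · have hρ : 0 < R * (1 / 2) ^ j := by positivity
      have hd : 0 < gauge ξ := lt_of_lt_of_le (by positivity) hξ.1
      have hlog : Real.log (2 ^ (j + 1)) = ((j : ℝ) + 1) * Real.log 2 := by
        rw [Real.log_pow]; push_cast; ring
      rw [← hlog]
      refine Real.log_le_log (by positivity) ?_
      rw [le_div_iff₀ hd]
      have h2 : (2 : ℝ) ^ (j + 1) * (R * (1 / 2) ^ j * 2) = 4 * R := by
        have : (2 : ℝ) ^ j * (1 / 2) ^ j = 1 := by rw [← mul_pow]; norm_num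
        calc _ = 4 * R * ((2 : ℝ) ^ j * (1 / 2) ^ j) := by ring
          _ = _ := by rw [this, mul_one]
      rw [← h2]
      have := hξ.2
      gcongr
    · by_contra hne
      exact absurd hξ.1 (not_le.2 (hsupp ξ hne))
  · intro r hr f hc hf hsupp
    rw [mul_assoc]
    refine (lintegral_div_log_rpow_le (ρ := fun j => r / 2 * 2 ^ j) hτ0 he
      (fun ξ hξ _ => exists_mem_shell_of_le hr (hsupp ξ hξ)) fun j ξ hξ _ => ?_).trans
      (mul_le_mul' le_rfl (h f hc hf 2 (r / 2) (Or.inl rfl) (by positivity) fun ξ hξ => ?_))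
    · have hlog : Real.log (2 ^ (j + 1)) = ((j : ℝ) + 1) * Real.log 2 := by
        rw [Real.log_pow]; push_cast; ring
      rw [← hlog]
      refine Real.log_le_log (by positivity) ?_
      rw [le_div_iff₀ hr]
      have := hξ.1
      calc (2 : ℝ) ^ (j + 1) * r = 4 * (r / 2 * 2 ^ j * 1) := by ring
        _ ≤ 4 * gauge ξ := by gcongr
    · by_contra hne
      have h1 := hξ.2
      have h2 := hsupp ξ hne
      linarith

theorem seminorm_rpow (s p α a : ℝ) (f : Heisenberg n → ℝ) :
    seminorm s p α f ^ a = (∫⁻ ξ, ∫⁻ η, kernel p (p * s) ((p - 2) * α) f ξ η) ^ (a / p) := by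
  rw [seminorm, ← ENNReal.rpow_mul, one_div_mul_eq_div]
  rfl

theorem eLpNorm_ofReal_rpow {q : ℝ} (hq : 0 < q) (t : ℝ) (f : Heisenberg n → ℝ) :
    eLpNorm f (ENNReal.ofReal q) volume ^ t = (∫⁻ ξ, ‖f ξ‖ₑ ^ q) ^ (t / q) := by
  rw [eLpNorm_eq_lintegral_rpow_enorm_toReal (by simpa using hq) ENNReal.ofReal_ne_top,
    ENNReal.toReal_ofReal hq.le, ← ENNReal.rpow_mul, one_div_mul_eq_div]

end Heisenberg

/-! ### Exponents and conclusion -/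

/-- Arithmetic of the exponents, with `θ = (p - 2)α / (ps)`. The balance and criticality conditions
force `ps(1 + θ) ≥ Q`, which with `psθ < Q - 2` makes the weight integrable over the unit shell. -/
theorem exponent_relations {Q p s τ a γ q θ : ℝ} (hQ : 2 < Q) (hp : 1 < p)
    (hτ : 1 < τ) (ha0 : 0 < a) (ha1 : a ≤ 1) (hq1 : 1 ≤ q) (hθ0 : 0 ≤ θ) (hκ : p * s * θ < Q - 2)
    (hq : (1 - a) * τ * Q / (Q - 2 + τ * γ * θ) < q)
    (hbal : 0 = a * (1 / p - s * (1 + θ) / Q) + (1 - a) / q) (hγ1 : -γ ≤ a * s)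
    (hcrit : 1 / τ + γ * (1 + θ) / Q = 0) :
    Q ≤ p * s + p * s * θ ∧ 0 ≤ (1 - a) * τ / q ∧ (1 - a) * τ / q < 1 ∧
      1 - (1 - a) * τ / q ≤ a * τ / p ∧ 0 < -(τ * γ) ∧ 0 ≤ -(τ * γ * θ) ∧
      -(τ * γ * θ) / (1 - (1 - a) * τ / q) < Q - 2 ∧ -(τ * γ) + -(τ * γ * θ) = Q ∧
      (p * s + p * s * θ - Q) * (a * τ / p) = Q * ((1 - a) * τ / q) := by
  have hQ0 : 0 < Q := by linarith
  have hp0 : 0 < p := by linarith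
  have hτ0 : 0 < τ := by linarith
  have hq0 : 0 < q := by linarith
  have h1θ : 0 < 1 + θ := by linarith
  have hγ : τ * γ * (1 + θ) = -Q := by
    have : (1 / τ + γ * (1 + θ) / Q) * (τ * Q) = 0 := by rw [hcrit, zero_mul]
    field_simp at this
    linarith
  have hbal' : a * (s * (1 + θ) / Q - 1 / p) = (1 - a) / q := by linarith
  have haq : 0 ≤ (1 - a) / q := div_nonneg (by linarith) hq0.le
  have hSκ : Q ≤ p * s + p * s * θ := by
    have hsQ : 1 / p ≤ s * (1 + θ) / Q := by
      by_contra! h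
      have := mul_neg_of_pos_of_neg ha0 (sub_neg.2 h)
      linarith
    rw [div_le_div_iff₀ hp0 hQ0] at hsQ
    linarith
  set v := (1 - a) * τ / q with hv
  have heb : -(τ * γ) + -(τ * γ * θ) = Q := by linarith
  have he0 : 0 < -(τ * γ) := by
    by_contra! h
    have := mul_nonneg (by linarith : 0 ≤ τ * γ) h1θ.le
    linarith
  have hb0 : 0 ≤ -(τ * γ * θ) := by
    have := mul_nonneg he0.le hθ0
    linarith
  have hv0 : 0 ≤ v := div_nonneg (mul_nonneg (by linarith) hτ0.le) hq0.le
  have hbQ : -(τ * γ * θ) < Q - 2 := by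
    have h1 : -(τ * γ * θ) * (1 + θ) = Q * θ := by linear_combination (-θ) * hγ
    have h2 : -(τ * γ * θ) * (1 + θ) ≤ p * s * θ * (1 + θ) := by
      rw [h1]
      calc Q * θ ≤ (p * s + p * s * θ) * θ := by gcongr
        _ = _ := by ring
    exact (le_of_mul_le_mul_right h2 h1θ).trans_lt hκ
  have hvQ : v * Q < Q - 2 + τ * γ * θ := by
    rw [div_lt_iff₀ (by linarith)] at hq
    rw [hv, div_mul_eq_mul_div, div_lt_iff₀ hq0]
    linarith
  have hv1 : v < 1 := by
    by_contra! h
    have := mul_le_mul_of_nonneg_right h hQ0.le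
    linarith
  refine ⟨hSκ, hv0, hv1, ?_, he0, hb0, ?_, heb, ?_⟩
  · have h2 : 1 / τ = -γ * (1 + θ) / Q := by
      have : -γ * (1 + θ) / Q = -(γ * (1 + θ) / Q) := by ring
      linarith
    have h3 : -γ * (1 + θ) / Q ≤ a * s * (1 + θ) / Q := by gcongr
    have h4 : a * s * (1 + θ) / Q = a / p + (1 - a) / q := by
      rw [← hbal']; ring
    have h5 : a * τ / p + v = τ * (a / p + (1 - a) / q) := by rw [hv]; ring
    have h6 : τ * (1 / τ) ≤ τ * (a / p + (1 - a) / q) := by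
      gcongr; linarith
    rw [mul_one_div_cancel hτ0.ne'] at h6
    linarith
  · rw [div_lt_iff₀ (by linarith)]
    have : (Q - 2) * (1 - v) = Q - 2 - v * Q + 2 * v := by ring
    linarith
  · have h1 : (p * s + p * s * θ - Q) * (a * τ / p) =
        τ * Q * (a * (s * (1 + θ) / Q - 1 / p)) := by field_simp
    rw [h1, hbal', hv]; ring

end

theorem theorem1p3 (n : ℕ) (hn : 1 ≤ n) (p s α τ a γ q : ℝ)
    (hp : 1 < p) (hs0 : 0 < s) (hs1 : s < 1) (hτ : 1 < τ) (ha0 : 0 < a) (ha1 : a ≤ 1)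
    (hq1 : 1 ≤ q)
    (hα0 : 0 ≤ (p - 2) * α) (hα1 : (p - 2) * α < Heisenberg.homDim n - 2)
    (hq : (1 - a) * τ * Heisenberg.homDim n /
        (Heisenberg.homDim n - 2 + τ * γ * (p - 2) * (α / (p * s))) < q)
    (hbalance : 1 / τ + γ * (1 + (p - 2) * (α / (p * s))) / Heisenberg.homDim n =
        a * (1 / p - s * (1 + (p - 2) * (α / (p * s))) / Heisenberg.homDim n) + (1 - a) / q)
    (hγ0 : 0 ≤ -γ) (hγ1 : -γ ≤ a * s)
    (hcrit : 1 / τ + γ * (1 + (p - 2) * (α / (p * s))) / Heisenberg.homDim n = 0) :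
    ∃ C : ℝ, 0 < C ∧
      (∀ R : ℝ, 0 < R → ∀ f : Heisenberg n → ℝ, ContDiff ℝ 1 f → HasCompactSupport f →
        tsupport f ⊆ Heisenberg.gaugeBall 0 R →
        (∫⁻ ξ : Heisenberg n, ENNReal.ofReal
            (Heisenberg.gauge ξ ^ (τ * γ) *
                Heisenberg.zNorm ξ ^ (τ * γ * (p - 2) * (α / (p * s))) /
                Real.log (4 * R / Heisenberg.gauge ξ) ^ τ * |f ξ| ^ τ)) ^ (1 / τ) ≤
          ENNReal.ofReal C * Heisenberg.seminorm s p α f ^ a *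
            eLpNorm f (ENNReal.ofReal q) volume ^ (1 - a)) ∧
      (∀ r : ℝ, 0 < r → ∀ f : Heisenberg n → ℝ, ContDiff ℝ 1 f → HasCompactSupport f →
        tsupport f ∩ Heisenberg.gaugeBall 0 r = ∅ →
        (∫⁻ ξ : Heisenberg n, ENNReal.ofReal
            (Heisenberg.gauge ξ ^ (τ * γ) *
                Heisenberg.zNorm ξ ^ (τ * γ * (p - 2) * (α / (p * s))) /
                Real.log (4 * Heisenberg.gauge ξ / r) ^ τ * |f ξ| ^ τ)) ^ (1 / τ) ≤
          ENNReal.ofReal C * Heisenberg.seminorm s p α f ^ a *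
            eLpNorm f (ENNReal.ofReal q) volume ^ (1 - a)) := by
  have hn' : (1 : ℝ) ≤ n := by exact_mod_cast hn
  have hQ2 : Heisenberg.homDim n - 2 = 2 * n := by rw [Heisenberg.homDim]; ring
  have hp0 : 0 < p := by linarith
  have hτ0 : 0 < τ := by linarith
  have hq0 : 0 < q := by linarith
  have hps : 0 < p * s := by positivity
  have hbexp : τ * γ * (p - 2) * (α / (p * s)) = τ * γ * ((p - 2) * (α / (p * s))) := by ring
  have hθκ : p * s * ((p - 2) * (α / (p * s))) = (p - 2) * α := by field_simp
  set θ : ℝ := (p - 2) * (α / (p * s)) with hθ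
  have hθ0 : 0 ≤ θ := by
    by_contra! h
    have := mul_neg_of_pos_of_neg hps h
    linarith
  obtain ⟨hSκ, hv0, hv1, hcount, he0, hb0, hbv, heb, hscale⟩ := exponent_relations
    (by linarith : 2 < Heisenberg.homDim n) hp hτ ha0 ha1 hq1 hθ0 (by rw [hθκ]; exact hα1)
    (by rw [← hbexp]; exact hq) (by rw [← hbalance]; exact hcrit.symm) hγ1 hcrit
  rw [hθκ] at hSκ hscale
  rw [hQ2] at hbv
  set u := a * τ / p with hu
  set v := (1 - a) * τ / q with hv
  set e := -(τ * γ) with he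
  set b := -(τ * γ * θ) with hb
  have hτuv : u * p + v * q = τ := by rw [hu, hv]; field_simp; ring
  obtain ⟨C, hC, h₁, h₂⟩ := Heisenberg.exists_log_hardy_inequalities
    (n := n) (e := e) (b := b) hn hp hq1 hps.le
    hα0 hSκ hv0 hv1 hcount he0 hb0 hbv heb hscale (by rw [hτuv]; exact hτ)
  rw [hτuv] at h₁ h₂
  have he' : τ * γ = -e := by rw [he, neg_neg]
  have hb' : τ * γ * (p - 2) * (α / (p * s)) = -b := by rw [hbexp, hb, neg_neg]
  have hua : u * (1 / τ) = a / p := by rw [hu]; field_simp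
  have hva : v * (1 / τ) = (1 - a) / q := by rw [hv]; field_simp
  have hC' : C ^ (1 / τ) ≤ ENNReal.ofReal ((C ^ (1 / τ)).toReal + 1) := by
    rw [ENNReal.ofReal_add ENNReal.toReal_nonneg zero_le_one,
      ENNReal.ofReal_toReal (ENNReal.rpow_ne_top_of_nonneg (by positivity) hC)]
    exact le_self_add
  have hroot : ∀ (f : Heisenberg n → ℝ) (I : ENNReal),
      I ≤ C * ((∫⁻ ξ, ∫⁻ η, Heisenberg.kernel p (p * s) ((p - 2) * α) f ξ η) ^ u *
        (∫⁻ ξ, ‖f ξ‖ₑ ^ q) ^ v) →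
      I ^ (1 / τ) ≤ ENNReal.ofReal ((C ^ (1 / τ)).toReal + 1) * Heisenberg.seminorm s p α f ^ a *
        eLpNorm f (ENNReal.ofReal q) volume ^ (1 - a) := by
    intro f I hI
    have hτi : 0 ≤ 1 / τ := by positivity
    rw [Heisenberg.seminorm_rpow, Heisenberg.eLpNorm_ofReal_rpow hq0,
      ← hua, ← hva, ENNReal.rpow_mul, ENNReal.rpow_mul]
    calc I ^ (1 / τ) ≤ _ := ENNReal.rpow_le_rpow hI hτi
      _ = C ^ (1 / τ) * ((∫⁻ ξ, ∫⁻ η, Heisenberg.kernel p (p * s) ((p - 2) * α) f ξ η) ^ u) ^ (1 / τ) *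
            ((∫⁻ ξ, ‖f ξ‖ₑ ^ q) ^ v) ^ (1 / τ) := by
          rw [ENNReal.mul_rpow_of_nonneg _ _ hτi, ENNReal.mul_rpow_of_nonneg _ _ hτi, mul_assoc]
      _ ≤ _ := by gcongr
  rw [hb', he']
  refine ⟨(C ^ (1 / τ)).toReal + 1, by positivity, fun R hR f hf hfc hsupp => ?_,
    fun r hr f hf hfc hsupp => ?_⟩
  · refine hroot f _ (h₁ R hR f hf.continuous (hf.continuous.integrable_of_hasCompactSupport hfc)
      fun ξ hξ => ?_)
    simpa [Heisenberg.gaugeBall, Heisenberg.op_inverse_zero] using hsupp (subset_tsupport f hξ)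
  · refine hroot f _ (h₂ r hr f hf.continuous (hf.continuous.integrable_of_hasCompactSupport hfc)
      fun ξ hξ => ?_)
    by_contra! hlt
    have : ξ ∈ tsupport f ∩ Heisenberg.gaugeBall 0 r :=
      ⟨subset_tsupport f hξ, by simpa [Heisenberg.gaugeBall, Heisenberg.op_inverse_zero] using hlt⟩
    rw [hsupp] at this
    exact this
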